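/- Let $\mathbb{K}$ be a field with an automorphism $a\mapsto\overline{a}$ of order two, and let $\mathbb{F}=\{a\in\mathbb{K}:\overline a=a\}$ be its fixed field. The automorphism acts on $\mathbb{K}[x_1,\dots,x_m]$ coefficientwise, $g\mapsto\overline g$. Call a matrix $A$ over $\mathbb{K}$ Hermitian if $A=\overline{A}^{T}$, and call $q\in\mathbb{F}[x_1,\dots,x_m]$ a Hermitian square if $q=g\,\overline{g}$ for some $g\in\mathbb{K}[x_1,\dots,x_m]$. For a polynomial $f$ write $$\Delta_{ij}(f)=\frac{\partial f}{\partial x_i}\frac{\partial f}{\partial x_j}-f\,\frac{\partial^2 f}{\partial x_i\,\partial x_j}.$$ Let $0\le n\le m$ and let $f\in\mathbb{F}[x_1,\dots,x_m]$ be a polynomial of total degree $n$ that has degree at most one in each of the variables $x_1,\dots,x_n$ and in which the coefficient of the monomial $x_1\cdots x_n$ equals $1$. Then there exist Hermitian $n\times n$ matrices $A_0,A_{n+1},\dots,A_m$ over $\mathbb{K}$ such that $$f=\det\Big(\operatorname{diag}(x_1,\dots,x_n)+\sum_{j=n+1}^{m}x_jA_j+A_0\Big)$$ if and only if $\Delta_{ij}(f)$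 is a Hermitian square for all $i,j\in\{1,\dots,n\}$. In particular (the case $\mathbb{K}=\mathbb{C}$ with complex conjugation and $\mathbb{F}=\mathbb{R}$), a polynomial $f\in\mathbb{R}[x_1,\dots,x_m]$ of total degree $n\le m$ that has degree at most one in each of $x_1,\dots,x_n$ and in which the coefficient of $x_1\cdots x_n$ equals $1$ can be written in this form with complex Hermitian $n\times n$ matrices $A_0,A_{n+1},\dots,A_m$ if and only if for all $i,j\in\{1,\dots,n\}$ there is $g_{ij}\in\mathbb{C}[x_1,\dots,x_m]$ with $\Delta_{ij}(f)=g_{ij}\,\overline{g_{ij}}$. -/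

import Mathlib

open MvPolynomial

namespace HermitianDet

/-- The Rayleigh difference `Δ_ij(f) = ∂f/∂x_i · ∂f/∂x_j - f · ∂²f/∂x_i∂x_j`. -/
noncomputable def rayleigh {R τ : Type*} [CommRing R] (i j : τ) (f : MvPolynomial τ R) :
    MvPolynomial τ R :=
  pderiv i f * pderiv j f - f * pderiv i (pderiv j f)

/-- A square matrix is Hermitian with respect to the automorphism `σ` if it equals the transpose
of its entrywise image under `σ`. -/
def IsHermitianFor {K ι : Type*} [Field K] (σ : K ≃+* K) (A : Matrix ι ι K) : Prop :=
  A = (A.map σ).transpose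

/-- `q`, with coefficients in `F`, is a Hermitian square: `q = g · ḡ` for a polynomial `g` over `K`,
where `ḡ` arises from `g` by applying `σ` to the coefficients. -/
def IsHermitianSquare {F K τ : Type*} [Field F] [Field K] [Algebra F K] (σ : K ≃+* K)
    (q : MvPolynomial τ F) : Prop :=
  ∃ g : MvPolynomial τ K, map (algebraMap F K) q = g * map (σ : K →+* K) g

/-- The matrix `diag(x_1, …, x_n) + ∑_{j = n+1}^m x_j A_j + A_0` with polynomial entries.
The variables are indexed by `Fin m`, the first `n` of them being those with index `< n`. -/
noncomputable def pencil {K : Type*} [Field K] {n m : ℕ} (h : n ≤ m)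
    (A : {j : Fin m // n ≤ (j : ℕ)} → Matrix (Fin n) (Fin n) K) (A₀ : Matrix (Fin n) (Fin n) K) :
    Matrix (Fin n) (Fin n) (MvPolynomial (Fin m) K) :=
  Matrix.diagonal (fun i : Fin n => X (Fin.castLE h i)) +
    (∑ j : {j : Fin m // n ≤ (j : ℕ)}, (X j.1 : MvPolynomial (Fin m) K) • (A j).map C) + A₀.map C

/-- The standing hypotheses on `f ∈ R[x_1, …, x_m]`: its total degree is `n`, its degree in each of
`x_1, …, x_n` is at most one, and its coefficient of `x_1 ⋯ x_n` is one. -/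
def IsMonicMultiaffine {R : Type*} [CommRing R] {n m : ℕ} (h : n ≤ m)
    (f : MvPolynomial (Fin m) R) : Prop :=
  f.totalDegree = n ∧
    (∀ i : Fin n, f.degreeOf (Fin.castLE h i) ≤ 1) ∧
    f.coeff (∑ i : Fin n, Finsupp.single (Fin.castLE h i) 1) = 1

end HermitianDet

/-! Write a bar for the automorphism and `Δ_ij` for `Δ_ij(f)`.

Necessity: let `f = det M` with `M = diag(x) + B` and `B` free of the diagonal variables.
Differentiating `M · adj M = f · 1` in `x_j` and multiplying by `adj M` gives `(adj M)_ij (adj M)_ji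
= Δ_ij` (`adjugate_mul_adjugate`). If `M` is Hermitian then so is `adj M`, and the product is a
norm.

Sufficiency for irreducible `f` recovers a candidate `N` for `adj M` from `f`: a Hermitian matrix
with diagonal entries `∂_i f`, with `N_ij N_ji = Δ_ij`, and of rank one modulo `f`. A norm does not
determine its factor, since conjugate factors may be exchanged, so the entries must be chosen
compatibly. `IsAdjugateOn.exists_insert` adds one row and column at a time, and the gcd argument
`exists_norm_eq_forall_dvd` supplies the choice. For size `r`, rank one modulo `f` makes `f^(r-1)`
divide `det N` and, when `r ≥ 2`, `f^(r-2)` divide `adj N`. Degrees and leading coefficients give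
`det N = f^(r-1)`, and `adj N / f^(r-2)` is the required matrix (`hasHermitianDet_of_prime`).

For general `f`, an irreducible factor shares no diagonal variable with its cofactor. Since
`Δ_ij(uv) = v² Δ_ij(u)` when `v` is free of `x_i` and `x_j`, both factors inherit the norm
condition, and block diagonal sums reassemble `f` (`hasHermitianDet_of_card`). -/

namespace HermitianDet

/-! ### Norms and divisibility in a GCD domain with involution -/

section GCD

variable {R : Type*} [CommRing R] [IsDomain R] [NormalizedGCDMonoid R]

/-- In a GCD domain with an involution, a norm dividing a norm is the norm of a divisor. -/
theorem exists_norm_eq_dvd (b : R →+* R) (hb : ∀ x, b (b x) = x) {g₀ y : R}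
    (h : g₀ * b g₀ ∣ y * b y) : ∃ g, g * b g = g₀ * b g₀ ∧ g ∣ y := by
  rcases eq_or_ne g₀ 0 with rfl | hg
  · refine ⟨0, rfl, ?_⟩
    rw [zero_mul, zero_dvd_iff, mul_eq_zero] at h
    rcases h with h | h
    · rw [h]
    · rw [← hb y, h, map_zero]
  -- Here `u` is the gcd. As `v` is coprime to `w`, it divides `b w`, so `b v` divides `w`.
  -- Conjugating only the factor `v` of `g₀` keeps the norm and yields a divisor of `y`.
  obtain ⟨u, v, w, hvw, rfl, rfl⟩ : ∃ u v w, IsRelPrime v w ∧ g₀ = u * v ∧ y = u * w := by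
    obtain ⟨v, w, hvw, hv, hw⟩ := extract_gcd g₀ y
    exact ⟨gcd g₀ y, v, w, gcd_isUnit_iff_isRelPrime.1 hw, hvw, hv⟩
  have hu : u * b u ≠ 0 := by
    refine mul_ne_zero (left_ne_zero_of_mul hg) fun h0 => left_ne_zero_of_mul hg ?_
    rw [← hb u, h0, map_zero]
  have h1 : v * b v ∣ w * b w := by
    rw [← mul_dvd_mul_iff_left hu]
    simpa only [map_mul, mul_mul_mul_comm] using h
  have h2 : v ∣ b w := hvw.dvd_of_dvd_mul_left ((dvd_mul_right v (b v)).trans h1)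
  have h3 : b v ∣ w := by simpa [hb] using map_dvd b h2
  refine ⟨u * b v, ?_, mul_dvd_mul_left u h3⟩
  simp only [map_mul, hb]
  ring

/-- The gcd of the `y i` can be pulled out of one factor of the products, then, after conjugating,
out of the other. Thus the norm of `g₀` divides the norm of the gcd, and the case of a single
element applies. -/
theorem exists_norm_eq_forall_dvd {ι : Type*} (b : R →+* R) (hb : ∀ x, b (b x) = x) {g₀ : R}
    (s : Finset ι) (y : ι → R) (h : ∀ i ∈ s, ∀ j ∈ s, g₀ * b g₀ ∣ b (y i) * y j) :
    ∃ g, g * b g = g₀ * b g₀ ∧ ∀ i ∈ s, g ∣ y i := by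
  have hD : b (g₀ * b g₀) = g₀ * b g₀ := by rw [map_mul, hb, mul_comm]
  have key : ∀ z : R, (∀ j ∈ s, g₀ * b g₀ ∣ z * y j) → g₀ * b g₀ ∣ z * s.gcd y := by
    intro z hz
    have h1 : g₀ * b g₀ ∣ s.gcd fun j => z * y j := Finset.dvd_gcd hz
    exact h1.trans (Finset.gcd_mul_left' s y z).dvd
  have h2 : g₀ * b g₀ ∣ s.gcd y * b (s.gcd y) := by
    rw [mul_comm (s.gcd y)]
    refine key _ fun i hi => ?_
    have := map_dvd b (key _ fun j hj => h i hi j hj)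
    rwa [hD, map_mul, hb, mul_comm (y i)] at this
  obtain ⟨g, hg, hd⟩ := exists_norm_eq_dvd b hb h2
  exact ⟨g, hg, fun i hi => hd.trans (Finset.gcd_dvd hi)⟩

end GCD

/-! ### Degrees, elimination of a variable, and leading coefficients -/

section Degree

variable {τ R : Type*} [CommRing R]

theorem degreeOf_pderiv_le (l k : τ) (p : MvPolynomial τ R) :
    (pderiv k p).degreeOf l ≤ p.degreeOf l := by
  rw [degreeOf_le_iff]
  intro m hm
  rw [mem_support_iff, coeff_pderiv] at hm
  have := monomial_le_degreeOf l (mem_support_iff.2 (left_ne_zero_of_mul hm))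
  rw [Finsupp.add_apply] at this
  omega

theorem degreeOf_pderiv_self_le (k : τ) (p : MvPolynomial τ R) :
    (pderiv k p).degreeOf k ≤ p.degreeOf k - 1 := by
  rw [degreeOf_le_iff]
  intro m hm
  rw [mem_support_iff, coeff_pderiv] at hm
  have := monomial_le_degreeOf k (mem_support_iff.2 (left_ne_zero_of_mul hm))
  rw [Finsupp.add_apply, Finsupp.single_eq_same] at this
  omega

theorem totalDegree_pderiv_le (k : τ) (p : MvPolynomial τ R) :
    (pderiv k p).totalDegree ≤ p.totalDegree - 1 := by
  refine Finset.sup_le fun m hm => ?_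
  rw [mem_support_iff, coeff_pderiv] at hm
  have := le_totalDegree (mem_support_iff.2 (left_ne_zero_of_mul hm))
  rw [Finsupp.sum_add_index' (by simp) (by simp), Finsupp.sum_single_index rfl] at this
  omega

theorem degreeOf_map_of_injective {S : Type*} [CommRing S] {φ : R →+* S}
    (hφ : Function.Injective φ) (k : τ) (p : MvPolynomial τ R) :
    (map φ p).degreeOf k = p.degreeOf k := by
  rw [degreeOf_eq_sup, degreeOf_eq_sup, support_map_of_injective p hφ]

theorem totalDegree_map_of_injective {S : Type*} [CommRing S] {φ : R →+* S}
    (hφ : Function.Injective φ) (p : MvPolynomial τ R) :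
    (map φ p).totalDegree = p.totalDegree := by
  rw [totalDegree, totalDegree, support_map_of_injective p hφ]

theorem pderiv_eq_zero_of_degreeOf_eq_zero {k : τ} {p : MvPolynomial τ R}
    (h : p.degreeOf k = 0) : pderiv k p = 0 := by
  ext m
  rw [coeff_pderiv, coeff_zero]
  by_contra hm
  have := monomial_le_degreeOf k (mem_support_iff.2 (left_ne_zero_of_mul hm))
  rw [Finsupp.add_apply, Finsupp.single_eq_same] at this
  omega

variable (R) in
/-- The polynomials in which the variable `k` does not occur. -/
def freeOf (k : τ) : Subring (MvPolynomial τ R) where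
  carrier := {p | p.degreeOf k = 0}
  zero_mem' := degreeOf_zero k
  one_mem' := degreeOf_one k
  add_mem' {p q} hp hq := by
    have := degreeOf_add_le k p q
    simp only [Set.mem_ofPred_eq] at *
    omega
  mul_mem' {p q} hp hq := by
    have := degreeOf_mul_le k p q
    simp only [Set.mem_ofPred_eq] at *
    omega
  neg_mem' {p} hp := by
    simpa [degreeOf_neg] using hp

theorem mem_freeOf {k : τ} {p : MvPolynomial τ R} : p ∈ freeOf R k ↔ p.degreeOf k = 0 := Iff.rfl

theorem pderiv_mem_freeOf {k : τ} {p : MvPolynomial τ R} (h : p.degreeOf k ≤ 1) :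
    pderiv k p ∈ freeOf R k := by
  have := degreeOf_pderiv_self_le k p
  rw [mem_freeOf]
  omega

theorem sub_X_mul_pderiv_mem_freeOf {k : τ} {p : MvPolynomial τ R} (h : p.degreeOf k ≤ 1) :
    p - X k * pderiv k p ∈ freeOf R k := by
  classical
  rw [mem_freeOf, ← Nat.le_zero, degreeOf_le_iff]
  intro m hm
  rw [Nat.le_zero]
  by_contra hk
  rw [mem_support_iff, coeff_sub, coeff_X_mul', if_pos (Finsupp.mem_support_iff.2 hk),
    coeff_pderiv] at hm
  have hle : Finsupp.single k 1 ≤ m := by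
    rw [Finsupp.single_le_iff]
    omega
  rw [tsub_add_cancel_of_le hle, Finsupp.tsub_apply, Finsupp.single_eq_same] at hm
  by_cases h0 : coeff m p = 0
  · simp [h0] at hm
  have := monomial_le_degreeOf k (mem_support_iff.2 h0)
  have h1 : m k = 1 := by omega
  simp [h1] at hm

/-- Eliminating the variable `k` from `a` by means of `f`. -/
theorem elim_mem_freeOf {k : τ} {f a : MvPolynomial τ R} (hf : f.degreeOf k ≤ 1)
    (ha : a.degreeOf k ≤ 1) : pderiv k f * a - f * pderiv k a ∈ freeOf R k := by
  -- With `f = f₀ + x_k f₁` and `a = a₀ + x_k a₁` the expression is `f₁ a₀ - f₀ a₁`.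
  have h1 := sub_X_mul_pderiv_mem_freeOf hf
  have h2 := sub_X_mul_pderiv_mem_freeOf ha
  have h3 := sub_mem (mul_mem (pderiv_mem_freeOf hf) h2) (mul_mem h1 (pderiv_mem_freeOf ha))
  convert h3 using 1
  ring

/-- Only one pair of monomials contributes: on `I` both exponents are already at their upper bounds,
and off `I` both must vanish. -/
theorem coeff_add_mul_of_degreeOf_le {I : Set τ} {p q : MvPolynomial τ R} {m m' : τ →₀ ℕ}
    (hm : ∀ t ∉ I, m t = 0) (hm' : ∀ t ∉ I, m' t = 0) (hp : ∀ t ∈ I, p.degreeOf t ≤ m t)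
    (hq : ∀ t ∈ I, q.degreeOf t ≤ m' t) :
    coeff (m + m') (p * q) = coeff m p * coeff m' q := by
  classical
  rw [coeff_mul, Finset.sum_eq_single (m, m')]
  · rintro ⟨a, c⟩ hac hne
    by_contra h0
    have ha : ∀ t, a t ≤ p.degreeOf t := fun t =>
      monomial_le_degreeOf t (mem_support_iff.2 (left_ne_zero_of_mul h0))
    have hc : ∀ t, c t ≤ q.degreeOf t := fun t =>
      monomial_le_degreeOf t (mem_support_iff.2 (right_ne_zero_of_mul h0))
    rw [Finset.HasAntidiagonal.mem_antidiagonal] at hac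
    have h1 : ∀ t, a t + c t = m t + m' t := fun t => by
      simpa using DFunLike.congr_fun hac t
    apply hne
    have h2 : ∀ t, a t = m t ∧ c t = m' t := fun t => by
      have h3 := h1 t
      by_cases ht : t ∈ I
      · have := ha t; have := hc t; have := hp t ht; have := hq t ht
        omega
      · have := hm t ht; have := hm' t ht
        omega
    rw [Prod.mk.injEq]
    exact ⟨Finsupp.ext fun t => (h2 t).1, Finsupp.ext fun t => (h2 t).2⟩
  · intro h
    simp at h

theorem coeff_sum_prod_of_degreeOf_le {ι : Type*} {I : Set τ} (s : Finset ι)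
    (p : ι → MvPolynomial τ R) (m : ι → τ →₀ ℕ) (hm : ∀ i ∈ s, ∀ t ∉ I, m i t = 0)
    (hp : ∀ i ∈ s, ∀ t ∈ I, (p i).degreeOf t ≤ m i t) :
    coeff (∑ i ∈ s, m i) (∏ i ∈ s, p i) = ∏ i ∈ s, coeff (m i) (p i) := by
  classical
  induction s using Finset.induction_on with
  | empty => simp
  | insert a s ha ih =>
    rw [Finset.sum_insert ha, Finset.prod_insert ha, Finset.prod_insert ha,
      ← ih (fun i hi => hm i (Finset.mem_insert_of_mem hi))
        (fun i hi => hp i (Finset.mem_insert_of_mem hi))]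
    refine coeff_add_mul_of_degreeOf_le (I := I) (hm a (Finset.mem_insert_self a s)) ?_
      (hp a (Finset.mem_insert_self a s)) ?_
    · intro t ht
      rw [Finsupp.finsetSum_apply]
      exact Finset.sum_eq_zero fun i hi => hm i (Finset.mem_insert_of_mem hi) t ht
    · intro t ht
      rw [Finsupp.finsetSum_apply]
      exact (degreeOf_prod_le t s p).trans
        (Finset.sum_le_sum fun i hi => hp i (Finset.mem_insert_of_mem hi) t ht)

theorem totalDegree_pow_of_isDomain [IsDomain R] {p : MvPolynomial τ R} (hp : p ≠ 0) (n : ℕ) :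
    (p ^ n).totalDegree = n * p.totalDegree := by
  induction n with
  | zero => simp
  | succ n ih =>
    rw [pow_succ, totalDegree_mul_of_isDomain (pow_ne_zero n hp) hp, ih]
    ring

theorem degreeOf_det_le {ι : Type*} [Fintype ι] [DecidableEq ι] (t : τ)
    (Z : Matrix ι ι (MvPolynomial τ R)) (r : ι → ℕ) (h : ∀ i j, (Z i j).degreeOf t ≤ r i) :
    Z.det.degreeOf t ≤ ∑ i, r i := by
  rw [← Matrix.det_transpose, Matrix.det_apply]
  refine (degreeOf_sum_le t _ _).trans (Finset.sup_le fun σ _ => ?_)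
  have h1 : ((Equiv.Perm.sign σ) • ∏ i, Z.transpose (σ i) i).degreeOf t
      = (∏ i, Z.transpose (σ i) i).degreeOf t := by
    rcases Int.units_eq_one_or (Equiv.Perm.sign σ) with h | h <;> simp [h, degreeOf_neg]
  rw [h1]
  exact (degreeOf_prod_le t _ _).trans (Finset.sum_le_sum fun i _ => h i _)

theorem totalDegree_det_le {ι : Type*} [Fintype ι] [DecidableEq ι]
    (Z : Matrix ι ι (MvPolynomial τ R)) (r : ι → ℕ) (h : ∀ i j, (Z i j).totalDegree ≤ r i) :
    Z.det.totalDegree ≤ ∑ i, r i := by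
  rw [← Matrix.det_transpose, Matrix.det_apply]
  refine totalDegree_finsetSum_le fun σ _ => ?_
  have h1 : ((Equiv.Perm.sign σ) • ∏ i, Z.transpose (σ i) i).totalDegree
      = (∏ i, Z.transpose (σ i) i).totalDegree := by
    rcases Int.units_eq_one_or (Equiv.Perm.sign σ) with h | h <;> simp [h, totalDegree_neg]
  rw [h1]
  exact (totalDegree_finsetProd _ _).trans (Finset.sum_le_sum fun i _ => h i _)

end Degree

/-! ### Powers of a prime dividing a determinant -/

section Minors

variable {R ι : Type*} [CommRing R] [IsDomain R] [Fintype ι] [DecidableEq ι]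

/-- Row reduction with the pivot `Z a c`, leaving out the rows outside `s`. -/
theorem pow_card_dvd_det {f : R} (hf : Prime f) (Z : Matrix ι ι R) (a c : ι) (s : Finset ι)
    (has : a ∉ s) (hz : ¬ f ∣ Z a c) (h : ∀ i ∈ s, ∀ j, f ∣ Z a c * Z i j - Z i c * Z a j) :
    f ^ s.card ∣ Z.det := by
  have h1 : ∀ i j, ∃ q, i ∈ s → Z a c * Z i j - Z i c * Z a j = f * q := fun i j => by
    by_cases hi : i ∈ s
    · obtain ⟨q, hq⟩ := h i hi j
      exact ⟨q, fun _ => hq⟩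
    · exact ⟨0, fun h => absurd h hi⟩
  choose q hq using h1
  let v : ι → R := fun i => if i ∈ s then Z a c else 1
  let w : ι → R := fun i => if i ∈ s then f else 1
  let Q : Matrix ι ι R := Matrix.of fun i j => if i ∈ s then q i j else Z i j
  -- Scaling the rows in `s` by the pivot and subtracting multiples of row `a` makes each of them
  -- divisible by `f`. The power of the pivot this introduces is cancelled by primality.
  have h2 : (Matrix.of fun i j => v i * Z i j).det = (Matrix.of fun i j => w i * Q i j).det := by
    refine Matrix.det_eq_of_forall_row_eq_smul_add_const
      (fun i => if i ∈ s then Z i c else 0) a (by simp [has]) fun i j => ?_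
    by_cases hi : i ∈ s
    · have := hq i j hi
      simp only [Matrix.of_apply, v, w, Q, hi, has, if_true, if_false, one_mul]
      linear_combination this
    · simp [v, w, Q, hi, has]
  rw [Matrix.det_mul_column, Matrix.det_mul_column] at h2
  have hv : ∏ i, v i = Z a c ^ s.card := by
    simp [v, Finset.prod_ite_mem]
  have hw : ∏ i, w i = f ^ s.card := by
    simp [w, Finset.prod_ite_mem]
  rw [hv, hw] at h2
  exact hf.pow_dvd_of_dvd_mul_left s.card (fun h => hz (hf.dvd_of_dvd_pow h)) (Dvd.intro _ h2.symm)

end Minors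

/-! ### Rayleigh differences -/

section Rayleigh

variable {τ R : Type*} [CommRing R]

theorem pderiv_pderiv_comm (i j : τ) (f : MvPolynomial τ R) :
    pderiv i (pderiv j f) = pderiv j (pderiv i f) := by
  classical
  rcases eq_or_ne i j with rfl | hij
  · rfl
  ext m
  simp only [coeff_pderiv, Finsupp.add_apply, Finsupp.single_eq_of_ne hij,
    Finsupp.single_eq_of_ne hij.symm, add_zero]
  rw [add_right_comm]
  ring

theorem rayleigh_comm (i j : τ) (f : MvPolynomial τ R) : rayleigh i j f = rayleigh j i f := by
  rw [rayleigh, rayleigh, pderiv_pderiv_comm, mul_comm (pderiv i f)]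

theorem map_rayleigh {S : Type*} [CommRing S] (φ : R →+* S) (i j : τ) (f : MvPolynomial τ R) :
    map φ (rayleigh i j f) = rayleigh i j (map φ f) := by
  simp only [rayleigh, map_sub, map_mul, pderiv_map]

theorem rayleigh_self {i : τ} {f : MvPolynomial τ R} (h : f.degreeOf i ≤ 1) :
    rayleigh i i f = pderiv i f * pderiv i f := by
  rw [rayleigh, pderiv_eq_zero_of_degreeOf_eq_zero (pderiv_mem_freeOf h), mul_zero, sub_zero]

theorem rayleigh_mem_freeOf_left {i : τ} (j : τ) {f : MvPolynomial τ R} (h : f.degreeOf i ≤ 1) :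
    rayleigh i j f ∈ freeOf R i :=
  elim_mem_freeOf h ((degreeOf_pderiv_le _ _ _).trans h)

theorem rayleigh_mem_freeOf_right (i : τ) {j : τ} {f : MvPolynomial τ R} (h : f.degreeOf j ≤ 1) :
    rayleigh i j f ∈ freeOf R j := by
  rw [rayleigh_comm]
  exact rayleigh_mem_freeOf_left i h

theorem degreeOf_rayleigh_le (l i j : τ) (f : MvPolynomial τ R) :
    (rayleigh i j f).degreeOf l ≤ 2 * f.degreeOf l := by
  have h1 := degreeOf_pderiv_le l i f
  have h2 := degreeOf_pderiv_le l j f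
  have h3 := degreeOf_pderiv_le l i (pderiv j f)
  have h4 := degreeOf_mul_le l (pderiv i f) (pderiv j f)
  have h5 := degreeOf_mul_le l f (pderiv i (pderiv j f))
  refine (degreeOf_sub_le l _ _).trans (max_le ?_ ?_) <;> omega

theorem totalDegree_rayleigh_le (i j : τ) (f : MvPolynomial τ R) :
    (rayleigh i j f).totalDegree ≤ 2 * (f.totalDegree - 1) := by
  have h1 := totalDegree_pderiv_le i f
  have h2 := totalDegree_pderiv_le j f
  have h3 := totalDegree_pderiv_le i (pderiv j f)
  have h4 := totalDegree_mul (pderiv i f) (pderiv j f)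
  have h5 := totalDegree_mul f (pderiv i (pderiv j f))
  rcases Nat.eq_zero_or_pos f.totalDegree with h0 | h0
  · have hj : pderiv j f = 0 :=
      pderiv_eq_zero_of_degreeOf_eq_zero (Nat.le_zero.1 (h0 ▸ degreeOf_le_totalDegree f j))
    simp [rayleigh, hj]
  rcases Nat.lt_or_ge 1 f.totalDegree with h6 | h6
  · refine (totalDegree_sub _ _).trans (max_le ?_ ?_) <;> omega
  -- In degree one the truncated bound on `f · ∂_i ∂_j f` is 1 instead of 0, but the second
  -- derivative vanishes.
  · have hij : pderiv i (pderiv j f) = 0 :=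
      pderiv_eq_zero_of_degreeOf_eq_zero
        (Nat.le_zero.1 ((degreeOf_le_totalDegree (pderiv j f) i).trans (by omega)))
    rw [rayleigh, hij, mul_zero, sub_zero]
    omega

theorem rayleigh_mul {i j : τ} {f g : MvPolynomial τ R} (hi : g ∈ freeOf R i)
    (hj : g ∈ freeOf R j) : rayleigh i j (f * g) = g * g * rayleigh i j f := by
  simp only [rayleigh, pderiv_mul, map_add, pderiv_eq_zero_of_degreeOf_eq_zero hi,
    pderiv_eq_zero_of_degreeOf_eq_zero hj]
  simp only [mul_zero, add_zero, map_zero]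
  ring

end Rayleigh

/-! ### Norms of polynomials over a field -/

section Norm

variable {τ K : Type*} [Field K]

theorem map_map_self {σ : K →+* K} (hσ : ∀ a, σ (σ a) = a) (p : MvPolynomial τ K) :
    map σ (map σ p) = p := by
  rw [map_map, show σ.comp σ = RingHom.id K from RingHom.ext hσ, map_id]

theorem two_mul_degreeOf_le_of_norm {σ : K →+* K} {g d : MvPolynomial τ K} (h : g * map σ g = d)
    (l : τ) : 2 * g.degreeOf l ≤ d.degreeOf l := by
  rcases eq_or_ne g 0 with rfl | hg
  · simp
  have hg' : map σ g ≠ 0 := (map_ne_zero_iff _ (map_injective σ σ.injective)).2 hg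
  rw [← h, degreeOf_mul_eq hg hg', degreeOf_map_of_injective σ.injective]
  omega

theorem two_mul_totalDegree_le_of_norm {σ : K →+* K} {g d : MvPolynomial τ K}
    (h : g * map σ g = d) : 2 * g.totalDegree ≤ d.totalDegree := by
  rcases eq_or_ne g 0 with rfl | hg
  · simp
  have hg' : map σ g ≠ 0 := (map_ne_zero_iff _ (map_injective σ σ.injective)).2 hg
  rw [← h, totalDegree_mul_of_isDomain hg hg', totalDegree_map_of_injective σ.injective]
  omega

theorem not_dvd_of_degreeOf_lt {f g : MvPolynomial τ K} (l : τ) (hg : g ≠ 0)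
    (h : g.degreeOf l < f.degreeOf l) : ¬ f ∣ g := by
  rintro ⟨q, rfl⟩
  rw [degreeOf_mul_eq (left_ne_zero_of_mul hg) (right_ne_zero_of_mul hg)] at h
  omega

theorem exists_norm_eq_dvd_mvPolynomial {σ : K →+* K} (hσ : ∀ a, σ (σ a) = a)
    {g₀ y : MvPolynomial τ K} (h : g₀ * map σ g₀ ∣ y * map σ y) :
    ∃ g, g * map σ g = g₀ * map σ g₀ ∧ g ∣ y := by
  obtain ⟨inst⟩ : Nonempty (NormalizedGCDMonoid (MvPolynomial τ K)) := inferInstance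
  exact exists_norm_eq_dvd (map σ) (map_map_self hσ) h

theorem exists_norm_eq_forall_dvd_mvPolynomial {ι : Type*} {σ : K →+* K}
    (hσ : ∀ a, σ (σ a) = a) {g₀ : MvPolynomial τ K} (s : Finset ι) (y : ι → MvPolynomial τ K)
    (h : ∀ i ∈ s, ∀ j ∈ s, g₀ * map σ g₀ ∣ map σ (y i) * y j) :
    ∃ g, g * map σ g = g₀ * map σ g₀ ∧ ∀ i ∈ s, g ∣ y i := by
  obtain ⟨inst⟩ : Nonempty (NormalizedGCDMonoid (MvPolynomial τ K)) := inferInstance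
  exact exists_norm_eq_forall_dvd (map σ) (map_map_self hσ) s y h

end Norm

/-! ### Building the adjugate of an irreducible polynomial -/

section Irreducible

variable {τ K ι : Type*} [Field K] {σ : K →+* K} {e : ι → τ} {f : MvPolynomial τ K}

/-- If the difference vanished, `f` would divide some `∂_l f`, which is nonzero and of smaller
degree in `x_l`. -/
theorem rayleigh_ne_zero_of_prime (hf : Prime f) {i j : τ} (hi : f.degreeOf i = 1)
    (hj : f.degreeOf j = 1) : rayleigh i j f ≠ 0 := by
  have key : ∀ {l : τ}, f.degreeOf l = 1 → ¬ f ∣ pderiv l f := fun {l} hl => by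
    have hfree : (pderiv l f).degreeOf l = 0 := pderiv_mem_freeOf hl.le
    refine not_dvd_of_degreeOf_lt l (fun h0 => ?_) (by omega)
    have := sub_X_mul_pderiv_mem_freeOf hl.le
    rw [h0, mul_zero, sub_zero, mem_freeOf] at this
    omega
  intro h
  have h1 : f ∣ pderiv i f * pderiv j f := ⟨_, sub_eq_zero.1 h⟩
  exact (hf.dvd_or_dvd h1).elim (key hi) (key hj)

/-- `N` behaves on the index set `s` like the adjugate of a Hermitian matrix `diag(x) + A` with
determinant `f`: it is Hermitian, its diagonal consists of the partial derivatives of `f`, the norms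
of its entries are the Rayleigh differences, and it has rank one modulo `f`, as tested against row
and column `o`. -/
structure IsAdjugateOn (σ : K →+* K) (e : ι → τ) (f : MvPolynomial τ K) (o : ι) (s : Finset ι)
    (N : ι → ι → MvPolynomial τ K) : Prop where
  diag : ∀ i ∈ s, N i i = pderiv (e i) f
  herm : ∀ i ∈ s, ∀ j ∈ s, map σ (N i j) = N j i
  norm : ∀ i ∈ s, ∀ j ∈ s, N i j * N j i = rayleigh (e i) (e j) f
  rank : ∀ i ∈ s, ∀ j ∈ s, f ∣ pderiv (e o) f * N i j - N i o * N o j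

theorem IsAdjugateOn.degreeOf_le {o : ι} {s : Finset ι} {N : ι → ι → MvPolynomial τ K}
    (h : IsAdjugateOn σ e f o s N) {i j : ι} (hi : i ∈ s) (hj : j ∈ s) (l : τ) :
    (N i j).degreeOf l ≤ f.degreeOf l := by
  have h1 := h.norm i hi j hj
  rw [← h.herm i hi j hj] at h1
  have h2 := two_mul_degreeOf_le_of_norm h1 l
  have h3 := degreeOf_rayleigh_le l (e i) (e j) f
  omega

/-- Both sides are free of `x_k` and agree modulo `f`. Since `f` has degree one in `x_k`, their
difference is zero. This identity exhibits `Δ_ok` as a common divisor of all the products to which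
the gcd argument is applied. -/
theorem IsAdjugateOn.mul_eq_mul_elim (hbar : map σ f = f) (hdeg : ∀ i, f.degreeOf (e i) = 1)
    {o : ι} {s : Finset ι} (ho : o ∈ s) {N : ι → ι → MvPolynomial τ K}
    (h : IsAdjugateOn σ e f o s N) (k : ι) {i j : ι} (hi : i ∈ s) (hj : j ∈ s) :
    map σ (pderiv (e k) f * N o i - f * pderiv (e k) (N o i)) *
        (pderiv (e k) f * N o j - f * pderiv (e k) (N o j)) =
      rayleigh (e o) (e k) f * (pderiv (e k) f * N i j - f * pderiv (e k) (N i j)) := by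
  rw [map_sub, map_mul, map_mul, ← pderiv_map, ← pderiv_map, hbar, h.herm o ho i hi]
  obtain ⟨q, hq⟩ := h.rank i hi j hj
  have hle : ∀ {a b}, a ∈ s → b ∈ s → (N a b).degreeOf (e k) ≤ 1 := fun ha hb =>
    (h.degreeOf_le ha hb _).trans (hdeg k).le
  have hfree := sub_mem
    (mul_mem (elim_mem_freeOf (hdeg k).le (hle hi ho)) (elim_mem_freeOf (hdeg k).le (hle ho hj)))
    (mul_mem (rayleigh_mem_freeOf_right (e o) (hdeg k).le)
      (elim_mem_freeOf (hdeg k).le (hle hi hj)))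
  -- Modulo `f`, the first product is `(∂_k f)² N_io N_oj`, the second is `∂_o f (∂_k f)² N_ij`, and
  -- these agree by the rank condition.
  have hdvd : f ∣ (pderiv (e k) f * N i o - f * pderiv (e k) (N i o)) *
        (pderiv (e k) f * N o j - f * pderiv (e k) (N o j)) -
      rayleigh (e o) (e k) f * (pderiv (e k) f * N i j - f * pderiv (e k) (N i j)) := by
    refine ⟨-(pderiv (e k) f * N i o * pderiv (e k) (N o j)) -
      pderiv (e k) (N i o) * (pderiv (e k) f * N o j - f * pderiv (e k) (N o j)) +
      pderiv (e o) f * pderiv (e k) f * pderiv (e k) (N i j) + pderiv (e o) (pderiv (e k) f) *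
      (pderiv (e k) f * N i j - f * pderiv (e k) (N i j)) - pderiv (e k) f * pderiv (e k) f * q, ?_⟩
    rw [rayleigh]
    linear_combination (-(pderiv (e k) f * pderiv (e k) f)) * hq
  by_contra hne
  refine not_dvd_of_degreeOf_lt (e k) (sub_ne_zero.2 hne) ?_ hdvd
  rw [mem_freeOf] at hfree
  rw [hfree, hdeg]
  exact one_pos

/-- In `adj M` the identity `∂_k f · N_oi - f · ∂_k N_oi = N_ok N_ki` holds. So the left side `Y i`
must split as `g · z i` with one common `g = N_ok` of norm `Δ_ok`; the quotients `z i` form the new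
row. -/
theorem IsAdjugateOn.exists_insert [DecidableEq ι] (hσ : ∀ a, σ (σ a) = a) (hbar : map σ f = f)
    (hdeg : ∀ i, f.degreeOf (e i) = 1) (hf : Prime f) {o : ι} {s : Finset ι} (ho : o ∈ s) {k : ι}
    (hk : k ∉ s) (hΔ : ∃ g, rayleigh (e o) (e k) f = g * map σ g)
    {N : ι → ι → MvPolynomial τ K} (h : IsAdjugateOn σ e f o s N) :
    ∃ N', IsAdjugateOn σ e f o (insert k s) N' := by
  obtain ⟨g₀, hg₀⟩ := hΔ
  have hΔ0 := rayleigh_ne_zero_of_prime hf (hdeg o) (hdeg k)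
  let Y : ι → MvPolynomial τ K := fun i => pderiv (e k) f * N o i - f * pderiv (e k) (N o i)
  have hY : ∀ i ∈ s, ∀ j ∈ s, map σ (Y i) * Y j = rayleigh (e o) (e k) f *
      (pderiv (e k) f * N i j - f * pderiv (e k) (N i j)) := fun i hi j hj =>
    h.mul_eq_mul_elim hbar hdeg ho k hi hj
  obtain ⟨g, hg, hgY⟩ := exists_norm_eq_forall_dvd_mvPolynomial hσ (g₀ := g₀) s Y
    fun i hi j hj => ⟨_, by rw [hY i hi j hj, hg₀]⟩
  rw [← hg₀] at hg
  have hg0 : g ≠ 0 := fun h0 => hΔ0 (by rw [← hg, h0, zero_mul])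
  have hgσ : map σ g ≠ 0 := fun h0 => hΔ0 (by rw [← hg, h0, mul_zero])
  -- The norm of `g` is `Δ_ok`, which is free of `x_o`, whereas `f` is not.
  have hfg : ¬ f ∣ g := by
    refine not_dvd_of_degreeOf_lt (e o) hg0 ?_
    have h1 := two_mul_degreeOf_le_of_norm hg (e o)
    have h2 : (rayleigh (e o) (e k) f).degreeOf (e o) = 0 :=
      rayleigh_mem_freeOf_left (e k) (hdeg o).le
    rw [hdeg]
    omega
  have hz : ∀ i, ∃ z, i ∈ s → Y i = g * z := fun i => by
    by_cases hi : i ∈ s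
    · obtain ⟨z, hz⟩ := hgY i hi
      exact ⟨z, fun _ => hz⟩
    · exact ⟨0, fun h => absurd h hi⟩
  choose z hz using hz
  have hYo : Y o = rayleigh (e o) (e k) f := by
    simp only [Y, h.diag o ho]
    rw [rayleigh_comm, rayleigh]
  have hzo : z o = map σ g := by
    have h1 := hz o ho
    rw [hYo, ← hg] at h1
    exact (mul_left_cancel₀ hg0 h1).symm
  have hzz : ∀ i ∈ s, z i * map σ (z i) = rayleigh (e k) (e i) f := fun i hi => by
    have h1 := hY i hi i hi
    rw [hz i hi, map_mul, h.diag i hi, ← hg] at h1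
    refine mul_left_cancel₀ (mul_ne_zero hg0 hgσ) ?_
    rw [rayleigh]
    linear_combination h1
  have hrank : ∀ i ∈ s, f ∣ pderiv (e o) f * z i - map σ g * N o i := fun i hi => by
    -- After multiplication by `g` the claim reads `∂_o f · Y i ≡ Δ_ok N_oi` modulo `f`.
    refine (hf.dvd_or_dvd ?_).resolve_left hfg
    refine ⟨pderiv (e o) (pderiv (e k) f) * N o i - pderiv (e o) f * pderiv (e k) (N o i), ?_⟩
    have h1 := hz i hi
    simp only [Y] at h1
    have h2 := hg
    rw [rayleigh] at h2
    linear_combination (-(pderiv (e o) f)) * h1 - N o i * h2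
  have hne : ∀ {i}, i ∈ s → i ≠ k := fun hi hik => hk (hik ▸ hi)
  let N' : ι → ι → MvPolynomial τ K := fun i j =>
    if i = k then if j = k then pderiv (e k) f else z j
    else if j = k then map σ (z i) else N i j
  have hkk : N' k k = pderiv (e k) f := by simp [N']
  have hki : ∀ {i}, i ∈ s → N' k i = z i := fun hi => by simp [N', hne hi]
  have hik : ∀ {i}, i ∈ s → N' i k = map σ (z i) := fun hi => by simp [N', hne hi]
  have hij : ∀ {i j}, i ∈ s → j ∈ s → N' i j = N i j := fun hi hj => by
    simp [N', hne hi, hne hj]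
  refine ⟨N', ?_, ?_, ?_, ?_⟩
  · refine Finset.forall_mem_insert _ _ _ |>.2 ⟨hkk, fun i hi => ?_⟩
    rw [hij hi hi, h.diag i hi]
  · simp only [Finset.forall_mem_insert]
    refine ⟨⟨?_, fun i hi => ?_⟩, fun i hi => ⟨?_, fun j hj => ?_⟩⟩
    · rw [hkk, ← pderiv_map, hbar]
    · rw [hki hi, hik hi]
    · rw [hki hi, hik hi, map_map_self hσ]
    · rw [hij hi hj, hij hj hi, h.herm i hi j hj]
  · simp only [Finset.forall_mem_insert]
    refine ⟨⟨?_, fun i hi => ?_⟩, fun i hi => ⟨?_, fun j hj => ?_⟩⟩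
    · rw [hkk, rayleigh_self (hdeg k).le]
    · rw [hki hi, hik hi, hzz i hi]
    · rw [hki hi, hik hi, mul_comm, hzz i hi, rayleigh_comm]
    · rw [hij hi hj, hij hj hi, h.norm i hi j hj]
  · simp only [Finset.forall_mem_insert]
    refine ⟨⟨?_, fun i hi => ?_⟩, fun i hi => ⟨?_, fun j hj => ?_⟩⟩
    · rw [hkk, hki ho, hik ho, hzo, map_map_self hσ, mul_comm (map σ g), hg, rayleigh]
      exact ⟨pderiv (e o) (pderiv (e k) f), by ring⟩
    · rw [hki hi, hki ho, hij ho hi, hzo]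
      exact hrank i hi
    · rw [hik hi, hij hi ho, hik ho, hzo, map_map_self hσ]
      have h1 := map_dvd (map σ) (hrank i hi)
      rw [hbar, map_sub, map_mul, map_mul, ← pderiv_map, hbar, map_map_self hσ,
        h.herm o ho i hi] at h1
      rwa [mul_comm (N i o)]
    · rw [hij hi hj, hij hi ho, hij ho hj]
      exact h.rank i hi j hj

theorem exists_isAdjugateOn_univ [Fintype ι] (hσ : ∀ a, σ (σ a) = a) (hbar : map σ f = f)
    (hdeg : ∀ i, f.degreeOf (e i) = 1) (hf : Prime f) (o : ι)
    (hΔ : ∀ i j, ∃ g, rayleigh (e i) (e j) f = g * map σ g) :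
    ∃ N, IsAdjugateOn σ e f o Finset.univ N := by
  classical
  suffices h : ∀ s : Finset ι, ∃ N, IsAdjugateOn σ e f o (insert o s) N by
    obtain ⟨N, hN⟩ := h Finset.univ
    rw [Finset.insert_eq_of_mem (Finset.mem_univ o)] at hN
    exact ⟨N, hN⟩
  intro s
  induction s using Finset.induction_on with
  | empty =>
    -- Only the entry at `(o, o)` is constrained here.
    refine ⟨fun _ _ => pderiv (e o) f, ?_, ?_, ?_, ?_⟩
    · simp
    · simp [← pderiv_map, hbar]
    · simp [rayleigh_self (hdeg o).le]
    · simp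
  | insert k s hk ih =>
    obtain ⟨N, hN⟩ := ih
    rcases eq_or_ne k o with rfl | hko
    · rw [Finset.insert_idem]
      exact ⟨N, hN⟩
    rw [Finset.insert_comm]
    exact hN.exists_insert hσ hbar hdeg hf (Finset.mem_insert_self o s)
      (by simp [hko, hk]) (hΔ o k)

/-- Multiplied by `(∂_o f)²`, both products become `N_io N_oj N_ko N_ol` modulo `f`, and the prime
`f` does not divide `∂_o f`. -/
theorem IsAdjugateOn.dvd_minor (hdeg : ∀ i, f.degreeOf (e i) = 1) (hf : Prime f) {o : ι}
    {s : Finset ι} {N : ι → ι → MvPolynomial τ K} (h : IsAdjugateOn σ e f o s N)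
    {i j k l : ι} (hi : i ∈ s) (hj : j ∈ s) (hk : k ∈ s) (hl : l ∈ s) :
    f ∣ N i j * N k l - N k j * N i l := by
  have hfo : ¬ f ∣ pderiv (e o) f := by
    have h1 := rayleigh_ne_zero_of_prime hf (hdeg o) (hdeg o)
    rw [rayleigh_self (hdeg o).le] at h1
    refine not_dvd_of_degreeOf_lt (e o) (left_ne_zero_of_mul h1) ?_
    have h2 : (pderiv (e o) f).degreeOf (e o) = 0 := pderiv_mem_freeOf (hdeg o).le
    rw [hdeg]
    omega
  obtain ⟨q₁, h₁⟩ := h.rank i hi j hj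
  obtain ⟨q₂, h₂⟩ := h.rank k hk l hl
  obtain ⟨q₃, h₃⟩ := h.rank k hk j hj
  obtain ⟨q₄, h₄⟩ := h.rank i hi l hl
  refine (hf.dvd_or_dvd (a := pderiv (e o) f * pderiv (e o) f) ?_).resolve_left
    fun h => (hf.dvd_or_dvd h).elim hfo hfo
  refine ⟨q₁ * (pderiv (e o) f * N k l) + N i o * N o j * q₂ -
    q₃ * (pderiv (e o) f * N i l) - N k o * N o j * q₄, ?_⟩
  linear_combination pderiv (e o) f * N k l * h₁ + N i o * N o j * h₂ -
    pderiv (e o) f * N i l * h₃ - N k o * N o j * h₄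

end Irreducible

/-! ### Exponents of the leading monomials -/

section Boundary

variable {τ ι : Type*} [Fintype ι] {e : ι → τ}

/-- The exponent of the monomial `∏ x_{e i}`. -/
noncomputable def fullExponent (e : ι → τ) : τ →₀ ℕ := ∑ i, Finsupp.single (e i) 1

theorem fullExponent_apply (he : Function.Injective e) (k : ι) : fullExponent e (e k) = 1 := by
  classical
  rw [fullExponent, Finsupp.finsetSum_apply, Finset.sum_eq_single k]
  · simp
  · intro i _ hik
    exact Finsupp.single_eq_of_ne fun h => hik (he h).symm
  · simp

theorem fullExponent_eq_zero {t : τ} (ht : t ∉ Set.range e) : fullExponent e t = 0 := by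
  rw [fullExponent, Finsupp.finsetSum_apply]
  refine Finset.sum_eq_zero fun i _ => Finsupp.single_eq_of_ne ?_
  rintro rfl
  exact ht ⟨i, rfl⟩

theorem fullExponent_sum (e : ι → τ) :
    ((fullExponent e).sum fun _ n => n) = Fintype.card ι := by
  rw [fullExponent, ← Finsupp.sum_finsetSum_index (by simp) (by simp)]
  simp

/-- The exponent of the monomial `∏_{j ≠ i} x_{e j}`. -/
noncomputable def cofullExponent (e : ι → τ) (i : ι) : τ →₀ ℕ :=
  fullExponent e - Finsupp.single (e i) 1

theorem cofullExponent_apply [DecidableEq ι] (he : Function.Injective e) (i k : ι) :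
    cofullExponent e i (e k) = if i = k then 0 else 1 := by
  rw [cofullExponent, Finsupp.tsub_apply, fullExponent_apply he]
  split_ifs with h
  · simp [h]
  · rw [Finsupp.single_eq_of_ne fun h' => h (he h').symm, Nat.sub_zero]

theorem cofullExponent_eq_zero {t : τ} (ht : t ∉ Set.range e) (i : ι) :
    cofullExponent e i t = 0 := by
  rw [cofullExponent, Finsupp.tsub_apply, fullExponent_eq_zero ht, zero_tsub]

theorem sum_cofullExponent (he : Function.Injective e) :
    ∑ i, cofullExponent e i = ∑ _j : Fin (Fintype.card ι - 1), fullExponent e := by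
  classical
  ext t
  rw [Finsupp.finsetSum_apply, Finsupp.finsetSum_apply]
  by_cases ht : t ∈ Set.range e
  · obtain ⟨k, rfl⟩ := ht
    simp only [cofullExponent_apply he, fullExponent_apply he]
    rw [← Finset.sum_erase_add _ _ (Finset.mem_univ k), if_pos rfl, add_zero,
      Finset.sum_congr rfl fun i hi => if_neg (Finset.ne_of_mem_erase hi)]
    simp [Finset.card_erase_of_mem]
  · simp [cofullExponent_eq_zero ht, fullExponent_eq_zero ht]

theorem coeff_cofullExponent_pderiv {R : Type*} [CommRing R] (he : Function.Injective e)
    (f : MvPolynomial τ R) (i : ι) :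
    coeff (cofullExponent e i) (pderiv (e i) f) = coeff (fullExponent e) f := by
  classical
  have hle : Finsupp.single (e i) 1 ≤ fullExponent e := by
    rw [Finsupp.single_le_iff, fullExponent_apply he]
  rw [coeff_pderiv, cofullExponent_apply he, if_pos rfl, cofullExponent, tsub_add_cancel_of_le hle]
  simp

end Boundary

/-! ### The determinantal representation of an irreducible polynomial -/

section Representation

variable {τ K ι : Type*} [Field K] [Fintype ι] [DecidableEq ι] {σ : K →+* K} {e : ι → τ}
  {f : MvPolynomial τ K}

/-- `f` is the determinant of `diag(x) + B` for a Hermitian matrix `B` whose entries are polynomials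
of degree at most one in which neither the variables `x_{e i}` nor those absent from `f` occur. -/
def HasHermitianDet (σ : K →+* K) (e : ι → τ) (f : MvPolynomial τ K) : Prop :=
  ∃ B : Matrix ι ι (MvPolynomial τ K),
    (∀ i j, map σ (B i j) = B j i) ∧ (∀ i j, (B i j).totalDegree ≤ 1) ∧
    (∀ i j t, t ∈ Set.range e ∨ f.degreeOf t = 0 → (B i j).degreeOf t = 0) ∧
    f = (Matrix.diagonal (fun i => X (e i)) + B).det

/-- The monomial has the largest possible exponent in every diagonal variable. A permutation moving
`k` uses the entry `N (π k) k`, which lacks `x_{π k}`, so it cannot reach that exponent; only the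
product of the diagonal does. -/
theorem coeff_sum_cofullExponent_det (he : Function.Injective e)
    (hcoeff : coeff (fullExponent e) f = 1)
    {N : Matrix ι ι (MvPolynomial τ K)} (hdiag : ∀ i, N i i = pderiv (e i) f)
    (hle : ∀ i j k, (N i j).degreeOf (e k) ≤ 1)
    (hleft : ∀ i j, (N i j).degreeOf (e i) = 0) (hright : ∀ i j, (N i j).degreeOf (e j) = 0) :
    coeff (∑ i, cofullExponent e i) N.det = 1 := by
  have hb : ∀ i j k, (N j i).degreeOf (e k) ≤ cofullExponent e i (e k) := fun i j k => by
    rw [cofullExponent_apply he]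
    split_ifs with h
    · rw [← h, hright]
    · exact hle j i k
  rw [Matrix.det_apply, coeff_sum, Finset.sum_eq_single 1]
  · rw [Equiv.Perm.sign_one, one_smul]
    rw [coeff_sum_prod_of_degreeOf_le (I := Set.range e)]
    · refine Finset.prod_eq_one fun i _ => ?_
      rw [Equiv.Perm.one_apply, hdiag, coeff_cofullExponent_pderiv he, hcoeff]
    · exact fun i _ t ht => cofullExponent_eq_zero ht i
    · rintro i _ _ ⟨k, rfl⟩
      exact hb i _ k
  · intro π _ hπ
    obtain ⟨k, hk⟩ : ∃ k, π k ≠ k := by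
      by_contra! h
      exact hπ (Equiv.ext h)
    have h0 : coeff (∑ i, cofullExponent e i) (∏ i, N (π i) i) = 0 := by
      by_contra hne
      have h1 := monomial_le_degreeOf (e (π k)) (mem_support_iff.2 hne)
      have h2 := degreeOf_prod_le (e (π k)) Finset.univ fun i => N (π i) i
      rw [Finsupp.finsetSum_apply] at h1
      refine absurd (h1.trans h2) (not_le.2 (Finset.sum_lt_sum (fun i _ => hb i _ _)
        ⟨k, Finset.mem_univ k, ?_⟩))
      rw [hleft, cofullExponent_apply he, if_neg hk.symm]
      exact one_pos
    rcases Int.units_eq_one_or (Equiv.Perm.sign π) with h | h <;> simp [h, h0]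
  · simp

theorem hasHermitianDet_of_prime (hσ : ∀ a, σ (σ a) = a) (he : Function.Injective e)
    (hbar : map σ f = f) (hdeg : ∀ i, f.degreeOf (e i) = 1) (hf : Prime f) (o : ι)
    (htot : f.totalDegree = Fintype.card ι) (hcoeff : coeff (fullExponent e) f = 1)
    (hΔ : ∀ i j, ∃ g, rayleigh (e i) (e j) f = g * map σ g) : HasHermitianDet σ e f := by
  classical
  obtain ⟨N₀, hN⟩ := exists_isAdjugateOn_univ hσ hbar hdeg hf o hΔ
  set N : Matrix ι ι (MvPolynomial τ K) := Matrix.of N₀ with hNdef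
  obtain ⟨n, hn⟩ : ∃ n, Fintype.card ι = n + 1 :=
    Nat.exists_eq_succ_of_ne_zero (Fintype.card_pos_iff.2 ⟨o⟩).ne'
  have hf0 := hf.ne_zero
  have hpow0 : f ^ n ≠ 0 := pow_ne_zero _ hf0
  have hdiag : ∀ i, N i i = pderiv (e i) f := fun i => hN.diag i (Finset.mem_univ i)
  have hherm : ∀ i j, map σ (N i j) = N j i := fun i j =>
    hN.herm i (Finset.mem_univ i) j (Finset.mem_univ j)
  have hnorm : ∀ i j, N i j * map σ (N i j) = rayleigh (e i) (e j) f := fun i j => by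
    rw [hherm]
    exact hN.norm i (Finset.mem_univ i) j (Finset.mem_univ j)
  have hminor : ∀ i j k l, f ∣ N i j * N k l - N k j * N i l := fun i j k l =>
    hN.dvd_minor hdeg hf (Finset.mem_univ i) (Finset.mem_univ j) (Finset.mem_univ k)
      (Finset.mem_univ l)
  have hNdeg : ∀ i j t, (N i j).degreeOf t ≤ f.degreeOf t := fun i j t =>
    hN.degreeOf_le (Finset.mem_univ i) (Finset.mem_univ j) t
  have hleft : ∀ i j, (N i j).degreeOf (e i) = 0 := fun i j => by
    have h1 := two_mul_degreeOf_le_of_norm (hnorm i j) (e i)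
    have h2 : (rayleigh (e i) (e j) f).degreeOf (e i) = 0 :=
      rayleigh_mem_freeOf_left (e j) (hdeg i).le
    omega
  have hright : ∀ i j, (N i j).degreeOf (e j) = 0 := fun i j => by
    have h1 := two_mul_degreeOf_le_of_norm (hnorm i j) (e j)
    have h2 : (rayleigh (e i) (e j) f).degreeOf (e j) = 0 :=
      rayleigh_mem_freeOf_right (e i) (hdeg j).le
    omega
  have hNtot : ∀ i j, (N i j).totalDegree ≤ n := fun i j => by
    have h1 := two_mul_totalDegree_le_of_norm (hnorm i j)
    have h2 := totalDegree_rayleigh_le (e i) (e j) f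
    omega
  have hpivot : ∀ a, ¬ f ∣ N a a := fun a => by
    have h0 := rayleigh_ne_zero_of_prime hf (hdeg a) (hdeg a)
    rw [← hnorm] at h0
    refine not_dvd_of_degreeOf_lt (e a) (left_ne_zero_of_mul h0) ?_
    rw [hleft, hdeg]
    exact one_pos
  -- the determinant of `N`
  have hdvd : f ^ n ∣ N.det := by
    have h1 := pow_card_dvd_det hf N o o (Finset.univ.erase o) (by simp) (hpivot o)
      fun i _ j => hminor o o i j
    rwa [Finset.card_erase_of_mem (Finset.mem_univ o), Finset.card_univ, hn,
      Nat.add_sub_cancel] at h1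
  have hdet : N.det = f ^ n := by
    obtain ⟨c, hc⟩ := hdvd
    have h1 := coeff_sum_cofullExponent_det he hcoeff hdiag
      (fun i j k => (hNdeg i j _).trans (hdeg k).le) hleft hright
    have h0 : N.det ≠ 0 := fun h => by simp [h] at h1
    have hc0 : c ≠ 0 := fun h => h0 (by rw [hc, h, mul_zero])
    have h2 : N.det.totalDegree ≤ (n + 1) * n := by
      simpa [hn] using totalDegree_det_le N (fun _ => n) hNtot
    rw [hc, totalDegree_mul_of_isDomain hpow0 hc0, totalDegree_pow_of_isDomain hf0, htot, hn] at h2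
    -- `f ^ n` already has total degree `n (n + 1)`, the bound for `det N`. Comparing leading
    -- coefficients then gives `c = 1`.
    obtain ⟨a, rfl⟩ : ∃ a, c = C a := ⟨_, totalDegree_eq_zero_iff_eq_C.1 (by nlinarith)⟩
    have h3 : coeff (∑ i, cofullExponent e i) (f ^ n) = 1 := by
      rw [sum_cofullExponent he, hn, Nat.add_sub_cancel]
      have h4 := coeff_sum_prod_of_degreeOf_le (I := Set.range e) Finset.univ
        (fun _ : Fin n => f) (fun _ => fullExponent e) (fun _ _ _ ht => fullExponent_eq_zero ht)
        (by
          rintro _ _ _ ⟨k, rfl⟩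
          rw [fullExponent_apply he, hdeg])
      rw [hcoeff, Finset.prod_const, Finset.prod_const, one_pow, Finset.card_univ,
        Fintype.card_fin] at h4
      exact h4
    rw [hc, mul_comm, coeff_C_mul, h3, mul_one] at h1
    rw [hc, h1, C_1, mul_one]
  -- the adjugate of `N`
  have hadj : ∀ i j, f ^ n ∣ f * N.adjugate i j := fun i j => by
    by_cases hj : ∃ a, a ≠ j
    · obtain ⟨a, ha⟩ := hj
      obtain ⟨l, rfl⟩ : ∃ l, n = l + 1 := by
        refine Nat.exists_eq_succ_of_ne_zero fun h => ha ?_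
        rw [h] at hn
        exact (Fintype.card_eq_one_iff_nonempty_unique.1 hn).elim fun _ => Subsingleton.elim _ _
      rw [pow_succ', Matrix.adjugate_apply]
      refine mul_dvd_mul_left f ?_
      -- Besides the pivot row `a`, the replaced row `j` is left out, so `n - 1` rows contribute a
      -- factor `f`.
      have h1 := pow_card_dvd_det hf (N.updateRow j (Pi.single i 1)) a a
        ((Finset.univ.erase a).erase j) (by simp) (by simpa [Matrix.updateRow_ne ha] using hpivot a)
        (fun i' hi' j' => by
          rw [Matrix.updateRow_ne ha, Matrix.updateRow_ne (Finset.ne_of_mem_erase hi')]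
          exact hminor a a i' j')
      rwa [Finset.card_erase_of_mem (by simp [ha.symm]),
        Finset.card_erase_of_mem (Finset.mem_univ a), Finset.card_univ, hn] at h1
    · push Not at hj
      have h1 : Fintype.card ι = 1 := Fintype.card_eq_one_iff.2 ⟨j, hj⟩
      have h2 : n = 0 := by omega
      rw [h2, pow_zero]
      exact one_dvd _
  choose M₀ hM₀ using hadj
  set M : Matrix ι ι (MvPolynomial τ K) := Matrix.of M₀ with hMdef
  have hM : ∀ i j, f * N.adjugate i j = f ^ n * M i j := hM₀
  have hMN : M * N = f • (1 : Matrix ι ι (MvPolynomial τ K)) := by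
    have h1 : f ^ n • (M * N) = f ^ n • (f • (1 : Matrix ι ι (MvPolynomial τ K))) := by
      have h2 : f ^ n • M = f • N.adjugate := by
        ext1 i j
        exact (hM i j).symm
      rw [← Matrix.smul_mul, h2, Matrix.smul_mul, Matrix.adjugate_mul, hdet, smul_comm]
    exact smul_right_injective _ hpow0 h1
  have hMherm : ∀ i j, map σ (M i j) = M j i := fun i j => by
    have h1 : map σ (N.adjugate i j) = N.adjugate j i := by
      have h2 : (map σ).mapMatrix N = N.transpose := by
        ext1 a b
        exact hherm a b
      have h3 := congrFun (congrFun ((map σ).map_adjugate N) i) j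
      rw [h2, ← Matrix.adjugate_transpose] at h3
      exact h3
    have h2 := congrArg (map σ) (hM i j)
    rw [map_mul, map_mul, map_pow, hbar, h1, hM] at h2
    exact (mul_left_cancel₀ hpow0 h2).symm
  -- degrees of the entries of `M`
  have hMdeg : ∀ i j t r, (N.adjugate i j).degreeOf t ≤ r →
      n * f.degreeOf t + (M i j).degreeOf t ≤ max (n * f.degreeOf t) (f.degreeOf t + r) := by
    intro i j t r hr
    -- The first term of the maximum is there for a zero entry, whose degree carries no information.
    rcases eq_or_ne (M i j) 0 with h0 | h0
    · simp [h0]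
    have h1 := congrArg (degreeOf t) (hM i j)
    have h2 : f * N.adjugate i j ≠ 0 := by
      rw [hM]
      exact mul_ne_zero hpow0 h0
    rw [degreeOf_mul_eq hf0 (right_ne_zero_of_mul h2), degreeOf_mul_eq hpow0 h0,
      degreeOf_pow_eq _ _ _ hf0] at h1
    omega
  have hMtot : ∀ i j, (M i j).totalDegree ≤ 1 := fun i j => by
    rcases eq_or_ne (M i j) 0 with h0 | h0
    · simp [h0]
    have h1 := congrArg totalDegree (hM i j)
    have h2 : f * N.adjugate i j ≠ 0 := by
      rw [hM]
      exact mul_ne_zero hpow0 h0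
    rw [totalDegree_mul_of_isDomain hf0 (right_ne_zero_of_mul h2),
      totalDegree_mul_of_isDomain hpow0 h0, totalDegree_pow_of_isDomain hf0, htot, hn] at h1
    have h3 : (N.adjugate i j).totalDegree ≤ n * n := by
      rw [Matrix.adjugate_apply]
      refine (totalDegree_det_le _ (fun a => if a = j then 0 else n) fun a b => ?_).trans ?_
      · split_ifs with h
        · subst h
          rw [Matrix.updateRow_self, Pi.single_apply]
          split_ifs <;> simp
        · rw [Matrix.updateRow_ne h]
          exact hNtot a b
      · rw [← Finset.sum_erase_add _ _ (Finset.mem_univ j), if_pos rfl, add_zero,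
          Finset.sum_congr rfl fun a ha => if_neg (Finset.ne_of_mem_erase ha)]
        simp [Finset.card_erase_of_mem, hn]
    nlinarith
  have hadjdeg : ∀ i j t, (N.adjugate i j).degreeOf t ≤
      ∑ a, if a = j then 0 else if e a = t then 0 else f.degreeOf t := fun i j t => by
    rw [Matrix.adjugate_apply]
    refine degreeOf_det_le t _ _ fun a b => ?_
    split_ifs with h h'
    · subst h
      rw [Matrix.updateRow_self, Pi.single_apply]
      split_ifs <;> simp
    · rw [Matrix.updateRow_ne h, ← h', hleft]
    · rw [Matrix.updateRow_ne h]
      exact hNdeg a b t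
  have hMabsent : ∀ i j t, f.degreeOf t = 0 → (M i j).degreeOf t = 0 := fun i j t ht => by
    have h1 := hMdeg i j t 0 ((hadjdeg i j t).trans (by simp [ht]))
    simpa [ht] using h1
  have hMdiag : ∀ k, (M k k).degreeOf (e k) ≤ 1 := fun k =>
    (degreeOf_le_totalDegree _ _).trans (hMtot k k)
  -- In this cofactor row `j` is constant and row `k` is free of `x_k`, so its degree in `x_k` is at
  -- most `n - 1`. The equation `f · adj N = f^n · M` leaves degree zero for `M`.
  have hMfree' : ∀ i j k, k ≠ j → (M i j).degreeOf (e k) = 0 := fun i j k hkj => by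
    have h1 := hMdeg i j (e k) (n - 1) ((hadjdeg i j _).trans ?_)
    · have h2 : n ≠ 0 := fun h => hkj <| by
        rw [h] at hn
        exact (Fintype.card_eq_one_iff_nonempty_unique.1 hn).elim fun _ => Subsingleton.elim _ _
      rw [hdeg] at h1
      omega
    · rw [← Finset.sum_erase_add _ _ (Finset.mem_univ j), if_pos rfl, add_zero,
        ← Finset.sum_erase_add _ _ (Finset.mem_erase.2 ⟨hkj, Finset.mem_univ k⟩), if_neg hkj,
        if_pos rfl, add_zero]
      refine (Finset.sum_le_card_nsmul _ _ 1 fun a _ => ?_).trans ?_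
      · split_ifs <;> simp [hdeg]
      · simp [Finset.card_erase_of_mem, hkj, hn]
  have hMfree : ∀ i j k, ¬ (i = k ∧ j = k) → (M i j).degreeOf (e k) = 0 := fun i j k h => by
    by_cases hkj : k = j
    · rw [← hMherm j i, degreeOf_map_of_injective σ.injective]
      exact hMfree' j i k fun hki => h ⟨hki.symm, hkj.symm⟩
    · exact hMfree' i j k hkj
  -- In the `(k, k)` entry of `M N = f · 1` only `M k k` involves `x_k`, and its cofactor `N k k` is
  -- `∂_k f`.
  have hMder : ∀ k, pderiv (e k) (M k k) = 1 := fun k => by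
    have h1 := congrArg (pderiv (e k)) (congrFun (congrFun hMN k) k)
    rw [Matrix.mul_apply, map_sum, Finset.sum_eq_single k, pderiv_mul,
      pderiv_eq_zero_of_degreeOf_eq_zero (hleft k k), mul_zero, add_zero, Matrix.smul_apply,
      Matrix.one_apply_eq, smul_eq_mul, mul_one, hdiag] at h1
    · have h2 : pderiv (e k) f ≠ 0 := by
        rw [← hdiag]
        exact fun h => hpivot k (h ▸ dvd_zero f)
      exact mul_right_cancel₀ h2 (h1.trans (one_mul _).symm)
    · intro j _ hj
      rw [pderiv_mul, pderiv_eq_zero_of_degreeOf_eq_zero (hMfree k j k fun h => hj h.2),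
        pderiv_eq_zero_of_degreeOf_eq_zero (hright j k), zero_mul, mul_zero, add_zero]
    · simp
  have hMdet : M.det = f := by
    have h1 := congrArg Matrix.det hMN
    rw [Matrix.det_mul, hdet, Matrix.det_smul, Matrix.det_one, mul_one, hn, pow_succ'] at h1
    exact mul_right_cancel₀ hpow0 h1
  refine ⟨M - Matrix.diagonal fun i => X (e i), fun i j => ?_, fun i j => ?_, fun i j t ht => ?_,
    by rw [add_sub_cancel, hMdet]⟩
  · rw [Matrix.sub_apply, Matrix.sub_apply, map_sub, hMherm]
    rcases eq_or_ne i j with rfl | hij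
    · simp
    · simp [hij, hij.symm]
  · rw [Matrix.sub_apply]
    refine (totalDegree_sub _ _).trans (max_le (hMtot i j) ?_)
    rcases eq_or_ne i j with rfl | hij
    · simp
    · simp [hij]
  · rw [Matrix.sub_apply]
    rcases eq_or_ne i j with rfl | hij
    · rw [Matrix.diagonal_apply_eq]
      by_cases hti : t = e i
      · have h1 := sub_X_mul_pderiv_mem_freeOf (hMdiag i)
        rw [hMder, mul_one] at h1
        rw [hti]
        exact h1
      · have hX : X (e i) ∈ freeOf K t := degreeOf_X_of_ne hti
        refine sub_mem (H := freeOf K t) ?_ hX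
        rcases ht with ⟨k, rfl⟩ | ht
        · exact hMfree i i k fun h => hti (h.1 ▸ rfl)
        · exact hMabsent i i t ht
    · rw [Matrix.diagonal_apply_ne _ hij, sub_zero]
      rcases ht with ⟨k, rfl⟩ | ht
      · exact hMfree i j k fun h => hij (h.1.trans h.2.symm)
      · exact hMabsent i j t ht

end Representation

/-! ### Reduction to irreducible factors -/

section Decomposition

variable {τ K : Type*} [Field K] {σ : K →+* K} {f : MvPolynomial τ K}

theorem fullExponent_add_fullExponent {ι : Type*} [Fintype ι] (e : ι → τ) (p : ι → Prop)
    [DecidablePred p] : fullExponent (fun i : {i // p i} => e i) +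
      fullExponent (fun i : {i // ¬ p i} => e i) = fullExponent e :=
  Fintype.sum_subtype_add_sum_subtype p fun i => Finsupp.single (e i) 1

theorem card_le_totalDegree {ι : Type*} [Fintype ι] {e : ι → τ}
    (h : coeff (fullExponent e) f ≠ 0) : Fintype.card ι ≤ f.totalDegree := by
  rw [← fullExponent_sum e]
  exact le_totalDegree (mem_support_iff.2 h)

/-- The norm `v² Δ_ij(u)` of `g` is divisible by the norm `v²`, so `g` has a divisor of norm `v²`,
and the quotient has norm `Δ_ij(u)`. -/
theorem exists_norm_rayleigh_of_mul (hσ : ∀ a, σ (σ a) = a) {u v : MvPolynomial τ K} (hv0 : v ≠ 0)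
    (hv : map σ v = v) {i j : τ} (hi : v ∈ freeOf K i) (hj : v ∈ freeOf K j)
    (h : ∃ g, rayleigh i j (u * v) = g * map σ g) : ∃ g, rayleigh i j u = g * map σ g := by
  obtain ⟨g, hg⟩ := h
  rw [rayleigh_mul hi hj] at hg
  obtain ⟨g', hg', w, rfl⟩ := exists_norm_eq_dvd_mvPolynomial hσ (g₀ := v) (y := g)
    ⟨_, by rw [hv, ← hg]⟩
  rw [hv] at hg'
  refine ⟨w, mul_left_cancel₀ (mul_ne_zero hv0 hv0) ?_⟩
  rw [hg, map_mul, ← hg']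
  ring

/-- A multiaffine polynomial splits off an irreducible factor; the variables occurring in it are
separated from those of the remaining factor, and both factors are monic. -/
theorem exists_irreducible_factor_monic {ι : Type*} [Fintype ι] [Nonempty ι] {e : ι → τ}
    (he : Function.Injective e) (hdeg : ∀ i, f.degreeOf (e i) ≤ 1)
    (hcoeff : coeff (fullExponent e) f = 1) :
    ∃ (p : ι → Prop) (_ : DecidablePred p) (u v : MvPolynomial τ K), Irreducible u ∧ f = u * v ∧
      (∀ i, p i → u.degreeOf (e i) = 1) ∧ (∀ i, ¬ p i → u.degreeOf (e i) = 0) ∧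
      coeff (fullExponent fun i : {i // p i} => e i) u = 1 ∧
      coeff (fullExponent fun i : {i // ¬ p i} => e i) v = 1 := by
  classical
  have hf0 : f ≠ 0 := fun h => by simp [h] at hcoeff
  have hunit : ¬ IsUnit f := fun h => by
    obtain ⟨i⟩ := ‹Nonempty ι›
    have h1 := monomial_le_degreeOf (e i) (mem_support_iff.2 (hcoeff.trans_ne one_ne_zero))
    obtain ⟨a, -, rfl⟩ := (isUnit_iff_eq_C_of_isReduced).1 h
    rw [fullExponent_apply he, degreeOf_C] at h1
    omega
  obtain ⟨u, hu, v, rfl⟩ := WfDvdMonoid.exists_irreducible_factor hunit hf0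
  have hu0 := left_ne_zero_of_mul hf0
  have hv0 := right_ne_zero_of_mul hf0
  obtain ⟨p, hp⟩ : ∃ p : ι → Prop, ∀ i, p i ↔ u.degreeOf (e i) = 1 := ⟨_, fun _ => Iff.rfl⟩
  have hsum : ∀ i, u.degreeOf (e i) + v.degreeOf (e i) ≤ 1 := fun i => by
    rw [← degreeOf_mul_eq hu0 hv0]
    exact hdeg i
  have hprod : coeff (fullExponent fun i : {i // p i} => e i) u *
      coeff (fullExponent fun i : {i // ¬ p i} => e i) v = 1 := by
    rw [← coeff_add_mul_of_degreeOf_le (I := Set.range e), fullExponent_add_fullExponent e, hcoeff]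
    · exact fun t ht => fullExponent_eq_zero fun ⟨i, hi⟩ => ht ⟨i, hi⟩
    · exact fun t ht => fullExponent_eq_zero fun ⟨i, hi⟩ => ht ⟨i, hi⟩
    · rintro _ ⟨i, rfl⟩
      have h1 := hsum i
      by_cases hi : p i
      · rw [fullExponent_apply (e := fun i : {i // p i} => e i)
          (he.comp Subtype.val_injective) ⟨i, hi⟩]
        omega
      · rw [hp] at hi
        omega
    · rintro _ ⟨i, rfl⟩
      have h1 := hsum i
      by_cases hi : p i
      · rw [hp] at hi
        omega
      · rw [fullExponent_apply (e := fun i : {i // ¬ p i} => e i)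
          (he.comp Subtype.val_injective) ⟨i, hi⟩]
        omega
  set a := coeff (fullExponent fun i : {i // p i} => e i) u with ha
  set b := coeff (fullExponent fun i : {i // ¬ p i} => e i) v with hb
  have hb0 : b ≠ 0 := right_ne_zero_of_mul (hprod.trans_ne one_ne_zero)
  have hbu : IsUnit (C b : MvPolynomial τ K) := hb0.isUnit.map C
  have hdb : ∀ t, (C b * u).degreeOf t = u.degreeOf t := fun t =>
    degreeOf_C_mul t b (mem_nonZeroDivisors_of_ne_zero hb0)
  -- The leading coefficients satisfy `a b = 1`, so exchanging them as scalars makes both factors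
  -- monic without changing the product.
  refine ⟨p, inferInstance, C b * u, C a * v, (irreducible_isUnit_mul hbu).2 hu, ?_,
    fun i hi => ?_, fun i hi => ?_, ?_, ?_⟩
  · rw [mul_mul_mul_comm, ← C_mul, mul_comm b, hprod, C_1, one_mul]
  · rw [hdb, (hp i).1 hi]
  · have h1 := hsum i
    rw [hp] at hi
    rw [hdb]
    omega
  · rw [coeff_C_mul, ← ha, mul_comm, hprod]
  · rw [coeff_C_mul, ← hb, hprod]

/-- By its degree in `x_t`, `u` cannot divide the conjugate of `v`, so it divides its own conjugate.
Equal total degrees make the quotient constant, and the leading coefficient makes it 1. -/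
theorem map_eq_self_of_irreducible_factor {ι : Type*} [Fintype ι] {e : ι → τ}
    {u v : MvPolynomial τ K} (hu : Irreducible u) (hv0 : v ≠ 0)
    (huv : map σ (u * v) = u * v) (hcoeff : coeff (fullExponent e) u = 1) {t : τ}
    (hvt : v.degreeOf t < u.degreeOf t) : map σ u = u := by
  have hinj := map_injective (σ := τ) σ σ.injective
  have hdvd : u ∣ map σ u * map σ v := ⟨v, by rw [← map_mul, huv]⟩
  obtain ⟨q, hq⟩ := (hu.prime.dvd_or_dvd hdvd).resolve_right
    (not_dvd_of_degreeOf_lt t ((map_ne_zero_iff _ hinj).2 hv0)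
      (by rwa [degreeOf_map_of_injective σ.injective]))
  have h0 : u * q ≠ 0 := by
    rw [← hq]
    exact (map_ne_zero_iff _ hinj).2 hu.ne_zero
  have h1 := congrArg totalDegree hq
  rw [totalDegree_map_of_injective σ.injective,
    totalDegree_mul_of_isDomain hu.ne_zero (right_ne_zero_of_mul h0)] at h1
  obtain ⟨a, rfl⟩ : ∃ a, q = C a := ⟨_, totalDegree_eq_zero_iff_eq_C.1 (by omega)⟩
  have h2 := congrArg (coeff (fullExponent e)) hq
  rw [coeff_map, mul_comm, coeff_C_mul, hcoeff, map_one, mul_one] at h2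
  rw [hq, ← h2, C_1, mul_one]

/-- The blocks sit on a block diagonal. A diagonal variable of one block is absent from the other
factor; this is why `HasHermitianDet` also excludes absent variables from `B`. -/
theorem HasHermitianDet.mul {ι : Type*} [Fintype ι] [DecidableEq ι] {e : ι → τ} (p : ι → Prop)
    [DecidablePred p] {u v : MvPolynomial τ K}
    (hu0 : u ≠ 0) (hv0 : v ≠ 0) (hup : ∀ i, ¬ p i → u.degreeOf (e i) = 0)
    (hvp : ∀ i, p i → v.degreeOf (e i) = 0)
    (hu : HasHermitianDet σ (fun i : {i // p i} => e i) u)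
    (hv : HasHermitianDet σ (fun i : {i // ¬ p i} => e i) v) : HasHermitianDet σ e (u * v) := by
  obtain ⟨B, hB, hBtot, hBdeg, hBdet⟩ := hu
  obtain ⟨D, hD, hDtot, hDdeg, hDdet⟩ := hv
  let E : Matrix ι ι (MvPolynomial τ K) := Matrix.of fun i j =>
    if hi : p i then if hj : p j then B ⟨i, hi⟩ ⟨j, hj⟩ else 0
    else if hj : p j then 0 else D ⟨i, hi⟩ ⟨j, hj⟩
  have h11 : ∀ {i j} (hi : p i) (hj : p j), E i j = B ⟨i, hi⟩ ⟨j, hj⟩ := fun hi hj => by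
    simp [E, hi, hj]
  have h10 : ∀ {i j} (_ : p i) (_ : ¬ p j), E i j = 0 := fun hi hj => by simp [E, hi, hj]
  have h01 : ∀ {i j} (_ : ¬ p i) (_ : p j), E i j = 0 := fun hi hj => by simp [E, hi, hj]
  have h00 : ∀ {i j} (hi : ¬ p i) (hj : ¬ p j), E i j = D ⟨i, hi⟩ ⟨j, hj⟩ := fun hi hj => by
    simp [E, hi, hj]
  refine ⟨E, fun i j => ?_, fun i j => ?_, fun i j t ht => ?_, ?_⟩
  · by_cases hi : p i <;> by_cases hj : p j
    · rw [h11 hi hj, h11 hj hi, hB]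
    · rw [h10 hi hj, h01 hj hi, map_zero]
    · rw [h01 hi hj, h10 hj hi, map_zero]
    · rw [h00 hi hj, h00 hj hi, hD]
  · by_cases hi : p i <;> by_cases hj : p j
    · rw [h11 hi hj]
      exact hBtot _ _
    · simp [h10 hi hj]
    · simp [h01 hi hj]
    · rw [h00 hi hj]
      exact hDtot _ _
  · rw [degreeOf_mul_eq hu0 hv0] at ht
    by_cases hi : p i <;> by_cases hj : p j
    · rw [h11 hi hj]
      refine hBdeg _ _ t ?_
      rcases ht with ⟨k, rfl⟩ | ht
      · by_cases hk : p k
        · exact Or.inl ⟨⟨k, hk⟩, rfl⟩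
        · exact Or.inr (hup k hk)
      · exact Or.inr (by omega)
    · simp [h10 hi hj]
    · simp [h01 hi hj]
    · rw [h00 hi hj]
      refine hDdeg _ _ t ?_
      rcases ht with ⟨k, rfl⟩ | ht
      · by_cases hk : p k
        · exact Or.inr (hvp k hk)
        · exact Or.inl ⟨⟨k, hk⟩, rfl⟩
      · exact Or.inr (by omega)
  · rw [Matrix.twoBlockTriangular_det _ p]
    · conv_lhs => rw [hBdet, hDdet]
      congr 2
      · ext1 i j
        rw [Matrix.toSquareBlockProp_def, Matrix.of_apply, Matrix.add_apply, Matrix.add_apply,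
          h11 i.2 j.2, Matrix.diagonal_apply, Matrix.diagonal_apply]
        simp only [Subtype.ext_iff]
      · ext1 i j
        rw [Matrix.toSquareBlockProp_def, Matrix.of_apply, Matrix.add_apply, Matrix.add_apply,
          h00 i.2 j.2, Matrix.diagonal_apply, Matrix.diagonal_apply]
        simp only [Subtype.ext_iff]
    · intro i hi j hj
      rw [Matrix.add_apply, h01 hi hj, Matrix.diagonal_apply_ne _ (by rintro rfl; exact hi hj),
        add_zero]

/-- Each factor has total degree at least its number of diagonal variables, so the bound on the sum
forces equality for both. The irreducible factor contains a diagonal variable, so the cofactor has a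
smaller index set. -/
theorem hasHermitianDet_of_card (hσ : ∀ a, σ (σ a) = a) (n : ℕ) {ι : Type*} [Fintype ι]
    [DecidableEq ι] (hn : Fintype.card ι = n) {e : ι → τ} (he : Function.Injective e)
    (hbar : map σ f = f) (hdeg : ∀ i, f.degreeOf (e i) ≤ 1)
    (htot : f.totalDegree ≤ Fintype.card ι) (hcoeff : coeff (fullExponent e) f = 1)
    (hΔ : ∀ i j, ∃ g, rayleigh (e i) (e j) f = g * map σ g) : HasHermitianDet σ e f := by
  induction n using Nat.strong_induction_on generalizing ι f with
  | _ n ih =>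
    rcases isEmpty_or_nonempty ι with hι | hι
    · rw [Fintype.card_eq_zero, Nat.le_zero] at htot
      obtain ⟨a, rfl⟩ : ∃ a, f = C a := ⟨_, totalDegree_eq_zero_iff_eq_C.1 htot⟩
      have h1 : fullExponent e = 0 := by simp [fullExponent]
      rw [h1, coeff_zero_C] at hcoeff
      refine ⟨0, fun i => isEmptyElim i, fun i => isEmptyElim i, fun i => isEmptyElim i, ?_⟩
      rw [hcoeff, C_1, Matrix.det_isEmpty]
    obtain ⟨p, _, u, v, hu, rfl, hpu, hup, hcu, hcv⟩ :=
      exists_irreducible_factor_monic he hdeg hcoeff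
    have hu0 := hu.ne_zero
    have hv0 : v ≠ 0 := fun h => by simp [h] at hcv
    have hsum : ∀ i, u.degreeOf (e i) + v.degreeOf (e i) ≤ 1 := fun i => by
      rw [← degreeOf_mul_eq hu0 hv0]
      exact hdeg i
    have hvp : ∀ i, p i → v.degreeOf (e i) = 0 := fun i hi => by
      have h1 := hsum i
      rw [hpu i hi] at h1
      omega
    have hcard := Fintype.card_subtype_compl p
    have hcard' := Fintype.card_subtype_le p
    have htu := card_le_totalDegree (hcu.trans_ne one_ne_zero)
    have htv := card_le_totalDegree (hcv.trans_ne one_ne_zero)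
    rw [totalDegree_mul_of_isDomain hu0 hv0] at htot
    obtain ⟨o⟩ : Nonempty {i // p i} := by
      by_contra h
      rw [not_nonempty_iff] at h
      have h0 : Fintype.card {i // p i} = 0 := Fintype.card_eq_zero
      have h1 : u.totalDegree = 0 := by omega
      refine hu.not_isUnit ?_
      rw [totalDegree_eq_zero_iff_eq_C.1 h1] at hu0 ⊢
      exact (IsUnit.mk0 _ fun h0 => hu0 (by rw [h0, C_0])).map C
    have hubar := map_eq_self_of_irreducible_factor hu hv0 hbar hcu (t := e o)
      (by rw [hvp o o.2, hpu o o.2]; exact one_pos)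
    have hvbar : map σ v = v := by
      rw [map_mul, hubar] at hbar
      exact mul_left_cancel₀ hu0 hbar
    have hpos : 0 < Fintype.card {i // p i} := Fintype.card_pos_iff.2 ⟨o⟩
    refine HasHermitianDet.mul p hu0 hv0 hup hvp ?_ ?_
    · refine hasHermitianDet_of_prime hσ (he.comp Subtype.val_injective) hubar
        (fun i => hpu i i.2) hu.prime o (by omega) hcu fun i j => ?_
      exact exists_norm_rayleigh_of_mul hσ hv0 hvbar (hvp i i.2) (hvp j j.2) (hΔ i j)
    · refine ih (Fintype.card {i // ¬ p i}) (by omega) rfl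
        (he.comp Subtype.val_injective) hvbar (fun i => ?_) (by omega) hcv fun i j => ?_
      · have h1 := hsum i
        omega
      · refine exists_norm_rayleigh_of_mul hσ hu0 hubar (hup i i.2) (hup j j.2) ?_
        rw [mul_comm v u]
        exact hΔ i j

end Decomposition

/-! ### The adjugate identity behind necessity -/

section Adjugate

variable {τ R ι : Type*} [CommRing R] [DecidableEq ι] {e : ι → τ}

theorem diagonal_add_mem_freeOf (he : Function.Injective e)
    {B : Matrix ι ι (MvPolynomial τ R)} (hB : ∀ i j k, B i j ∈ freeOf R (e k)) {j : ι} (i k : ι)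
    (hij : i ≠ j) :
    (Matrix.diagonal (fun i => X (e i)) + B : Matrix ι ι (MvPolynomial τ R)) i k ∈
      freeOf R (e j) := by
  rw [Matrix.add_apply, Matrix.diagonal_apply]
  refine add_mem ?_ (hB i k j)
  split_ifs
  · exact degreeOf_X_of_ne fun h => hij (he h).symm
  · exact zero_mem _

/-- Only row `j` involves `x_j`, so the determinant is affine in `x_j` with slope the `(j, j)`
cofactor. -/
theorem pderiv_det_diagonal_add [Fintype ι] (he : Function.Injective e)
    {B : Matrix ι ι (MvPolynomial τ R)} (hB : ∀ i j k, B i j ∈ freeOf R (e k)) (j : ι) :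
    pderiv (e j) (Matrix.diagonal (fun i => X (e i)) + B).det =
      (Matrix.diagonal (fun i => X (e i)) + B).adjugate j j := by
  set M : Matrix ι ι (MvPolynomial τ R) := Matrix.diagonal (fun i => X (e i)) + B with hM
  have hrow : M = M.updateRow j (X (e j) • Pi.single j 1 + B j) := by
    ext1 i k
    rcases eq_or_ne i j with rfl | hij
    · rw [Matrix.updateRow_self, hM, Matrix.add_apply, Matrix.diagonal_apply]
      rcases eq_or_ne i k with rfl | hik
      · simp
      · simp [hik, hik.symm]
    · rw [Matrix.updateRow_ne hij]
  have hfree : ∀ w : ι → MvPolynomial τ R, (∀ k, w k ∈ freeOf R (e j)) →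
      (M.updateRow j w).det.degreeOf (e j) = 0 := fun w hw => by
    refine Nat.le_zero.1 ((degreeOf_det_le (e j) _ (fun _ => 0) fun i k => ?_).trans (by simp))
    rw [Nat.le_zero]
    rcases eq_or_ne i j with rfl | hij
    · rw [Matrix.updateRow_self]
      exact hw k
    · rw [Matrix.updateRow_ne hij]
      exact diagonal_add_mem_freeOf he hB i k hij
  have hdet : M.det = X (e j) * M.adjugate j j + (M.updateRow j (B j)).det := by
    conv_lhs => rw [hrow]
    rw [Matrix.det_updateRow_add, Matrix.det_updateRow_smul, Matrix.adjugate_apply]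
  have h1 : (M.adjugate j j).degreeOf (e j) = 0 := by
    rw [Matrix.adjugate_apply]
    refine hfree _ fun k => ?_
    rw [Pi.single_apply]
    split_ifs
    · exact one_mem _
    · exact zero_mem _
  rw [hdet, map_add, pderiv_mul, pderiv_X_self, one_mul, pderiv_eq_zero_of_degreeOf_eq_zero h1,
    pderiv_eq_zero_of_degreeOf_eq_zero (hfree _ fun k => hB j k j), mul_zero, add_zero, add_zero]

/-- The derivative of `adj M · M = det M` with respect to a diagonal variable. -/
theorem adjugate_mul_adjugate [Fintype ι] (he : Function.Injective e)
    {B : Matrix ι ι (MvPolynomial τ R)} (hB : ∀ i j k, B i j ∈ freeOf R (e k)) (i j : ι) :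
    (Matrix.diagonal (fun i => X (e i)) + B).adjugate i j *
        (Matrix.diagonal (fun i => X (e i)) + B).adjugate j i =
      rayleigh (e i) (e j) (Matrix.diagonal (fun i => X (e i)) + B).det := by
  have hi := pderiv_det_diagonal_add he hB i
  have hj := pderiv_det_diagonal_add he hB j
  set M : Matrix ι ι (MvPolynomial τ R) := Matrix.diagonal (fun i => X (e i)) + B with hM
  have hder : M.map (pderiv (e j)) = Matrix.single j j 1 := by
    ext1 a b
    rw [Matrix.map_apply, hM, Matrix.add_apply, map_add,
      pderiv_eq_zero_of_degreeOf_eq_zero (hB a b j), add_zero, Matrix.diagonal_apply,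
      Matrix.single_apply]
    rcases eq_or_ne a b with rfl | hab
    · rw [if_pos rfl]
      rcases eq_or_ne j a with rfl | hja
      · simp
      · rw [pderiv_X_of_ne fun h => hja (he h).symm, if_neg fun h => hja h.1]
    · rw [if_neg hab, map_zero, if_neg fun h => hab (h.1.symm.trans h.2)]
  have h1 : Matrix.single j j 1 * M.adjugate + M * M.adjugate.map (pderiv (e j)) =
      pderiv (e j) M.det • (1 : Matrix ι ι (MvPolynomial τ R)) := by
    rw [← hder]
    ext1 a b
    have h2 := congrArg (pderiv (e j)) (congrFun (congrFun M.mul_adjugate a) b)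
    rw [Matrix.mul_apply, map_sum] at h2
    simp only [Matrix.add_apply, Matrix.mul_apply, ← Finset.sum_add_distrib, Matrix.map_apply]
    simp only [pderiv_mul] at h2
    rw [h2, Matrix.smul_apply, Matrix.smul_apply, Matrix.one_apply]
    split_ifs <;> simp
  -- This yields `adj M · E_jj · adj M + f · ∂_j adj M = ∂_j f · adj M`, where `E_jj` is the matrix
  -- unit and `f = det M`; the `(i, i)` entry is the claim.
  have h2 := congrArg (M.adjugate * ·) h1
  simp only [mul_add, ← mul_assoc, Matrix.adjugate_mul, smul_mul_assoc, one_mul, mul_smul_comm,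
    mul_one] at h2
  have h3 := Matrix.ext_iff.2 h2 i i
  simp only [Matrix.add_apply, Matrix.smul_apply, smul_eq_mul, Matrix.map_apply] at h3
  rw [Matrix.mul_apply, Finset.sum_eq_single j, Matrix.mul_single_apply_same, mul_one, ← hi,
    pderiv_pderiv_comm (e j) (e i)] at h3
  · rw [rayleigh]
    linear_combination h3
  · intro b _ hb
    rw [Matrix.mul_single_apply_of_ne (hbj := hb), zero_mul]
  · simp

end Adjugate

/-! ### Affine polynomial matrices as pencils -/

section Pencil

theorem eq_sum_X_mul_C_add_C {τ R : Type*} [CommRing R] [Fintype τ] {p : MvPolynomial τ R}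
    (h : p.totalDegree ≤ 1) :
    p = ∑ j, X j * C (coeff (Finsupp.single j 1) p) + C (coeff 0 p) := by
  classical
  ext m
  rw [coeff_add, coeff_sum, coeff_C]
  simp only [mul_comm (X _), C_mul_X_eq_monomial, coeff_monomial]
  by_cases hp : coeff m p = 0
  · have h1 : ∀ q : τ →₀ ℕ, (if q = m then coeff q p else 0) = 0 := fun q => by
      split_ifs with hq
      · rw [hq, hp]
      · rfl
    rw [hp, h1, Finset.sum_eq_zero fun j _ => h1 _, add_zero]
  rcases eq_or_ne m 0 with rfl | hm
  · simp
  obtain ⟨j, hj⟩ : ∃ j, m j ≠ 0 := by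
    by_contra! h0
    exact hm (Finsupp.ext h0)
  have hle : Finsupp.single j 1 ≤ m := by
    rw [Finsupp.single_le_iff]
    omega
  obtain ⟨q, rfl⟩ := exists_add_of_le hle
  have h1 := (le_totalDegree (mem_support_iff.2 hp)).trans h
  rw [Finsupp.sum_add_index' (by simp) (by simp), Finsupp.sum_single_index rfl] at h1
  have hq : q = 0 := by
    ext t
    by_contra ht
    have h2 : q t ≤ q.sum fun _ n => n :=
      Finset.single_le_sum (f := q) (fun _ _ => Nat.zero_le _) (Finsupp.mem_support_iff.2 ht)
    rw [Finsupp.zero_apply] at ht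
    omega
  subst hq
  rw [add_zero] at hm ⊢
  rw [if_neg hm.symm, add_zero, Finset.sum_eq_single j, if_pos rfl]
  · intro i _ hij
    rw [if_neg]
    intro h3
    exact hij (Finsupp.single_left_injective one_ne_zero h3)
  · simp

variable {K : Type*} [Field K] {n m : ℕ} (h : n ≤ m)
  (A : {j : Fin m // n ≤ (j : ℕ)} → Matrix (Fin n) (Fin n) K) (A₀ : Matrix (Fin n) (Fin n) K)

theorem notMem_range_castLE (j : {j : Fin m // n ≤ (j : ℕ)}) (i : Fin n) :
    Fin.castLE h i ≠ j.1 := by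
  intro hij
  have h1 := j.2
  rw [← hij, Fin.val_castLE] at h1
  exact absurd i.2 (not_lt.2 h1)

/-- The part of the pencil without the diagonal variables. -/
noncomputable def pencilRest : Matrix (Fin n) (Fin n) (MvPolynomial (Fin m) K) :=
  Matrix.of fun a b => ∑ j : {j : Fin m // n ≤ (j : ℕ)}, X j.1 * C (A j a b) + C (A₀ a b)

theorem pencil_eq :
    pencil h A A₀ = Matrix.diagonal (fun i => X (Fin.castLE h i)) + pencilRest A A₀ := by
  rw [pencil, add_assoc]
  congr 1
  ext1 a b
  simp [pencilRest, Matrix.sum_apply]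

theorem pencilRest_mem_freeOf (a b k : Fin n) :
    pencilRest A A₀ a b ∈ freeOf K (Fin.castLE h k) := by
  have hC : ∀ c : K, C c ∈ freeOf K (Fin.castLE h k) := fun c => degreeOf_C c _
  refine add_mem (sum_mem fun j _ => mul_mem ?_ (hC _)) (hC _)
  exact degreeOf_X_of_ne (notMem_range_castLE h j k)

theorem map_pencil {σ : K ≃+* K} (hA : ∀ j, IsHermitianFor σ (A j)) (hA₀ : IsHermitianFor σ A₀) :
    (map (σ : K →+* K)).mapMatrix (pencil h A A₀) = (pencil h A A₀).transpose := by
  have h1 : ∀ {D : Matrix (Fin n) (Fin n) K}, IsHermitianFor σ D → ∀ a b, σ (D a b) = D b a :=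
    fun hD a b => (congrFun (congrFun hD b) a).symm
  rw [pencil_eq]
  ext1 a b
  simp only [RingHom.mapMatrix_apply, Matrix.map_apply, Matrix.add_apply, Matrix.transpose_apply,
    map_add]
  congr 1
  · rcases eq_or_ne a b with rfl | hab
    · simp
    · simp [hab, hab.symm]
  · simp [pencilRest, h1 hA₀, fun j => h1 (hA j)]

end Pencil

/-! ### The equivalence -/

section Main

variable {F K : Type*} [Field F] [Field K] [Algebra F K] {σ : K ≃+* K}

theorem exists_pencil_iff_isHermitianSquare (hσ : ∀ a, σ (σ a) = a)
    (hfix : ∀ a : F, σ (algebraMap F K a) = algebraMap F K a) {n m : ℕ} (h : n ≤ m)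
    (f : MvPolynomial (Fin m) F) (hf : IsMonicMultiaffine h f) :
    (∃ (A : {j : Fin m // n ≤ (j : ℕ)} → Matrix (Fin n) (Fin n) K)
        (A₀ : Matrix (Fin n) (Fin n) K), (∀ j, IsHermitianFor σ (A j)) ∧ IsHermitianFor σ A₀ ∧
        map (algebraMap F K) f = (pencil h A A₀).det) ↔
      ∀ i j : Fin n,
        IsHermitianSquare (K := K) σ (rayleigh (Fin.castLE h i) (Fin.castLE h j) f) := by
  have he := Fin.castLE_injective h
  have hinj := (algebraMap F K).injective
  simp only [IsHermitianSquare, map_rayleigh]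
  constructor
  · rintro ⟨A, A₀, hA, hA₀, hdet⟩ i j
    refine ⟨(pencil h A A₀).adjugate i j, ?_⟩
    have h1 := congrFun (congrFun ((map (σ : K →+* K)).map_adjugate (pencil h A A₀)) i) j
    rw [map_pencil h A A₀ hA hA₀, ← Matrix.adjugate_transpose] at h1
    have h2 := adjugate_mul_adjugate he (fun a b k => pencilRest_mem_freeOf h A A₀ a b k) i j
    rw [← pencil_eq, ← hdet] at h2
    rw [← h2]
    congr 1
    exact h1.symm
  · intro hΔ
    obtain ⟨htot, hdeg, hcoeff⟩ := hf
    have hbar : map (σ : K →+* K) (map (algebraMap F K) f) = map (algebraMap F K) f := by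
      rw [map_map]
      congr 1
      exact congrArg map (RingHom.ext hfix)
    obtain ⟨B, hB, hBtot, hBdeg, hdet⟩ := hasHermitianDet_of_card (σ := (σ : K →+* K)) hσ n
      (Fintype.card_fin n) he hbar
      (fun i => by rw [degreeOf_map_of_injective hinj]; exact hdeg i)
      (by rw [totalDegree_map_of_injective hinj, htot, Fintype.card_fin])
      (by rw [coeff_map, fullExponent, hcoeff, map_one]) hΔ
    have hherm : ∀ q, IsHermitianFor σ (Matrix.of fun a b => coeff q (B a b)) := fun q => by
      ext1 a b
      simp only [Matrix.transpose_apply, Matrix.map_apply, Matrix.of_apply]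
      rw [← hB b a, coeff_map]
      rfl
    refine ⟨fun j => Matrix.of fun a b => coeff (Finsupp.single j.1 1) (B a b),
      Matrix.of fun a b => coeff 0 (B a b), fun j => hherm _, hherm _, ?_⟩
    rw [hdet, pencil_eq]
    congr 2
    ext1 a b
    conv_lhs => rw [eq_sum_X_mul_C_add_C (hBtot a b)]
    rw [pencilRest, Matrix.of_apply]
    congr 1
    -- The sum over all variables splits, and the diagonal ones contribute nothing because they do
    -- not occur in `B`.
    rw [← Fintype.sum_subtype_add_sum_subtype fun j : Fin m => n ≤ (j : ℕ)]
    refine add_eq_left.2 (Finset.sum_eq_zero fun j _ => ?_)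
    have hj : Fin.castLE h ⟨j.1, not_le.1 j.2⟩ = j.1 := rfl
    have h0 : coeff (Finsupp.single j.1 1) (B a b) = 0 := by
      by_contra hne
      have h1 := monomial_le_degreeOf j.1 (mem_support_iff.2 hne)
      rw [hBdeg a b j.1 (Or.inl ⟨_, hj⟩), Finsupp.single_eq_same] at h1
      omega
    rw [h0, C_0, mul_zero]

end Main

end HermitianDet

/-- The first part is the statement over an arbitrary field `K` with an automorphism `σ` of order
two and fixed field `F`; the second part is the real/complex case. -/
theorem theorem5p1 :
    (∀ (F K : Type*) [Field F] [Field K] [Algebra F K] (σ : K ≃+* K),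
      orderOf σ = 2 →
      (∀ a : K, σ a = a ↔ a ∈ (algebraMap F K).range) →
      ∀ (n m : ℕ) (h : n ≤ m) (f : MvPolynomial (Fin m) F),
        HermitianDet.IsMonicMultiaffine h f →
        ((∃ (A : {j : Fin m // n ≤ (j : ℕ)} → Matrix (Fin n) (Fin n) K)
            (A₀ : Matrix (Fin n) (Fin n) K),
            (∀ j, HermitianDet.IsHermitianFor σ (A j)) ∧ HermitianDet.IsHermitianFor σ A₀ ∧
            MvPolynomial.map (algebraMap F K) f = (HermitianDet.pencil h A A₀).det) ↔
          ∀ i j : Fin n, HermitianDet.IsHermitianSquare σ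
            (HermitianDet.rayleigh (Fin.castLE h i) (Fin.castLE h j) f))) ∧
    (∀ (n m : ℕ) (h : n ≤ m) (f : MvPolynomial (Fin m) ℝ),
        HermitianDet.IsMonicMultiaffine h f →
        ((∃ (A : {j : Fin m // n ≤ (j : ℕ)} → Matrix (Fin n) (Fin n) ℂ)
            (A₀ : Matrix (Fin n) (Fin n) ℂ),
            (∀ j, (A j).IsHermitian) ∧ A₀.IsHermitian ∧
            MvPolynomial.map (algebraMap ℝ ℂ) f = (HermitianDet.pencil h A A₀).det) ↔
          ∀ i j : Fin n, ∃ g : MvPolynomial (Fin m) ℂ,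
            MvPolynomial.map (algebraMap ℝ ℂ)
                (HermitianDet.rayleigh (Fin.castLE h i) (Fin.castLE h j) f) =
              g * MvPolynomial.map (starRingEnd ℂ) g)) := by
  refine ⟨fun F K _ _ _ σ hσ hfix n m h f hf => ?_, fun n m h f hf => ?_⟩
  · refine HermitianDet.exists_pencil_iff_isHermitianSquare (fun a => ?_)
      (fun a => (hfix _).2 ⟨a, rfl⟩) h f hf
    have h1 := pow_orderOf_eq_one σ
    rw [hσ, pow_two] at h1
    exact RingEquiv.congr_fun h1 a
  · have h1 := HermitianDet.exists_pencil_iff_isHermitianSquare (F := ℝ) (K := ℂ)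
      (σ := starRingAut) star_star Complex.conj_ofReal h f hf
    have h2 : ∀ D : Matrix (Fin n) (Fin n) ℂ,
        HermitianDet.IsHermitianFor starRingAut D ↔ D.IsHermitian := fun D =>
      ⟨fun hD => hD.symm, fun hD => hD.symm⟩
    simp only [h2] at h1
    exact h1
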